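/- Let $S=S^{n-1}\subseteq\mathbb R^n$ be the unit sphere and let $\mu=\sum_{i=1}^k g_i\delta_{x_i}$ be a probability measure with $x_1,\dots,x_k\in S$ distinct, $g_i>0$ and $\sum_i g_i=1$. Let $(C_j)_{j\in\mathbb N}$ be an increasing sequence of finite subsets of $S$ whose union is dense in $S$. Put $$\alpha_j:=\max_{q\neq q'\in C_j}\langle q,q'\rangle,\qquad \theta_j:=\max_{1\le i\le k}\ \min_{q\in C_j}\arccos\langle q,x_i\rangle .$$ Assume that $\mu$ is easily approximable by $(C_j)_j$ with degrees $d_j$; that is, $(d_j)_j$ is a sequence of nonnegative integers such that 1. $(k-1)\left(\frac{1+\alpha_j}{2}\right)^{d_j}<\sqrt2-1$ for all sufficiently large $j$; 2. $\lim_{j\to\infty}\left(\frac{1+\cos\theta_j}{2}\right)^{d_j}=1$. In the degenerate case $k=1$, where condition 1 is vacuous, assume in addition that $\left(\frac{1+\alpha_j}{2}\right)^{d_j}<\sqrt2-1$ for all sufficiently large $j$. A Kostlan-Shub-Smale polynomial of degree $d$ is a random polynomial $P(y)=\sum_{|\alpha|\le d}A_\alpha y^\alpha$ in $n$ variables whose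 coefficients $A_\alpha$ are independent centred Gaussians with variance $2^{-d}\,\frac{d!}{(d-|\alpha|)!\prod_r\alpha_r!}$. Then there are deterministic sequences of integers $m_j\ge1$ and of reals $\tau_j\ge0$ such that the following holds. For each $j$ let $P^{(j)}_1,\dots,P^{(j)}_{m_j}$ be an independent sample of Kostlan-Shub-Smale polynomials of degree $d_j$, the samples for all $j$ being defined on one probability space, with an arbitrary dependence between different $j$. Let $M^{(j)}$ be the $m_j\times |C_j|$ matrix with entries $P^{(j)}_i(q)/\sqrt{m_j}$ for $q\in C_j$, and let $b^{(j)}_\mu\in\mathbb R^{m_j}$ be the vector with entries $\int_S P_i^{(j)}/\sqrt{m_j}\,d\mu$. Then almost surely: * for all sufficiently large $j$ the problem $$\min\|c\|_1\quad\text{subject to}\quad \|M^{(j)}c-b^{(j)}_\mu\|_2\le\tau_j\qquad(\ast_j)$$ has an optimum; * for every choice of optima $c_j^*$ of $(\ast_j)$ for all large $j$, with $t:=\frac12\min_i g_i$, $(h_j^*)_q:=(c_j^*)_q$ if $(c_j^*)_q>t$ and $(h_j^*)_q:=0$ otherwise, and $$\mu_{C_j}^*:=\frac{\sum_{q\in C_j}(h_j^*)_q\,\delta_q}{\|h_j^*\|_1},$$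 $\mu_{C_j}^*$ is a (well-defined) probability measure for all sufficiently large $j$, and $W(\mu_{C_j}^*,\mu)\to0$ as $j\to\infty$. Here $W(\nu_1,\nu_2)=\left(\inf_\lambda\int_{S\times S}\arccos(\langle X,Y\rangle)^2\,d\lambda(X,Y)\right)^{1/2}$, the infimum being over all couplings $\lambda$ of $\nu_1$ and $\nu_2$. -/

import Mathlib

open MeasureTheory ProbabilityTheory Filter Topology
open scoped NNReal ENNReal Matrix

noncomputable section

namespace SphereMoments

/-- The unit sphere `S^{n-1}` of `ℝ^n`. -/
abbrev Sph (n : ℕ) : Type := Metric.sphere (0 : EuclideanSpace ℝ (Fin n)) 1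

/-- The Euclidean inner product of two points of the sphere. -/
def sphInner {n : ℕ} (x y : Sph n) : ℝ :=
  inner ℝ (x : EuclideanSpace ℝ (Fin n)) (y : EuclideanSpace ℝ (Fin n))

/-- The geodesic (angular) distance on the sphere. -/
def sphDist {n : ℕ} (x y : Sph n) : ℝ := Real.arccos (sphInner x y)

/-! ### Point measures and the Wasserstein distance -/

/-- The point measure `∑ i, g i • δ_{x i}`. -/
def pointMeasure {n : ℕ} {ι : Type*} [Fintype ι] (g : ι → ℝ) (x : ι → Sph n) :
    Measure (Sph n) :=
  ∑ i, ENNReal.ofReal (g i) • Measure.dirac (x i)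

/-- The Wasserstein distance: the square root of the infimum of `∫ d(X,Y)^2 dγ` over all couplings
`γ` of the two measures. It is `⊤` when there is no coupling, so a finite value forces
the two measures to have equal total mass. -/
def wasserstein {n : ℕ} (ν₁ ν₂ : Measure (Sph n)) : ℝ≥0∞ :=
  (⨅ γ ∈ {γ : Measure (Sph n × Sph n) | γ.map Prod.fst = ν₁ ∧ γ.map Prod.snd = ν₂},
    ∫⁻ p, ENNReal.ofReal (sphDist p.1 p.2 ^ 2) ∂γ) ^ (1 / 2 : ℝ)

/-! ### Kostlan-Shub-Smale polynomials -/

/-- The multi-indices `α` with `n` parts and `|α| ≤ d`. -/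
def multiIndices (n d : ℕ) : Finset (Fin n → ℕ) :=
  (Fintype.piFinset fun _ : Fin n => Finset.range (d + 1)).filter fun α => ∑ r, α r ≤ d

/-- Membership in `multiIndices n d` is exactly the degree bound. -/
theorem mem_multiIndices {n d : ℕ} {α : Fin n → ℕ} :
    α ∈ multiIndices n d ↔ ∑ r, α r ≤ d := by
  simp only [multiIndices, Finset.mem_filter, Fintype.mem_piFinset, Finset.mem_range,
    and_iff_right_iff_imp]
  intro h r
  exact Nat.lt_succ_of_le
    ((Finset.single_le_sum (fun i _ => Nat.zero_le (α i)) (Finset.mem_univ r)).trans h)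

/-- The variance `binom(d, α) / 2^d`, where `binom(d, α) = d! / ((d - |α|)! ∏ α_r!)`. -/
def kssVariance {n : ℕ} (d : ℕ) (α : Fin n → ℕ) : ℝ≥0 :=
  (d.factorial : ℝ≥0) /
    (((d - ∑ r, α r).factorial : ℝ≥0) * ∏ r, ((α r).factorial : ℝ≥0)) / 2 ^ d

/-- The value at `y` of the polynomial `∑_{|α| ≤ d} a_α y^α`. -/
def polyEval {n d : ℕ} (a : multiIndices n d → ℝ) (y : Sph n) : ℝ :=
  ∑ α, a α * ∏ r, ((y : EuclideanSpace ℝ (Fin n)) r) ^ ((α : Fin n → ℕ) r)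

/-- `A i α` are the coefficients of an independent sample of `m` Kostlan-Shub-Smale polynomials of
degree `d`: all coefficients are independent, `A i α` being a centred Gaussian with variance
`binom(d, α) / 2^d`. -/
structure IsKSSSample {n d m : ℕ} {Ω : Type*} [MeasurableSpace Ω] (P : Measure Ω)
    (A : Fin m → multiIndices n d → Ω → ℝ) : Prop where
  hasLaw : ∀ i α, HasLaw (A i α) (gaussianReal 0 (kssVariance d (α : Fin n → ℕ))) P
  indep : iIndepFun (fun p : Fin m × multiIndices n d => A p.1 p.2) P

/-- The functions `P_i / √m`, where `P_i` is the polynomial with coefficients `a i`. -/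
def measFun {n d m : ℕ} (a : Fin m → multiIndices n d → ℝ) (i : Fin m) (y : Sph n) : ℝ :=
  polyEval (a i) y / √(m : ℝ)

/-- The normalized measurement matrix of the code `C`, with entries `P_i(q) / √m`. -/
def measMatrix {n d m : ℕ} (a : Fin m → multiIndices n d → ℝ) (C : Finset (Sph n)) :
    Matrix (Fin m) C ℝ :=
  Matrix.of fun i q => measFun a i (q : Sph n)

/-- The vector of moments of `ν` with respect to the functions `P_i / √m`. -/
def momentVec {n d m : ℕ} (a : Fin m → multiIndices n d → ℝ) (ν : Measure (Sph n)) :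
    Fin m → ℝ :=
  fun i => ∫ y, measFun a i y ∂ν

/-! ### The convex program and the thresholded measure -/

/-- `c` is feasible: `‖M c - b‖₂ ≤ τ`, in the Euclidean norm. -/
def IsFeasible {m : ℕ} {ι : Type*} [Fintype ι] (M : Matrix (Fin m) ι ℝ) (b : Fin m → ℝ) (τ : ℝ)
    (c : ι → ℝ) : Prop :=
  ‖WithLp.toLp 2 (M *ᵥ c - b)‖ ≤ τ

/-- `c` is an optimum of: minimize `‖c‖₁` subject to `‖M c - b‖₂ ≤ τ`. -/
def IsL1Optimum {m : ℕ} {ι : Type*} [Fintype ι] (M : Matrix (Fin m) ι ℝ) (b : Fin m → ℝ) (τ : ℝ)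
    (c : ι → ℝ) : Prop :=
  IsFeasible M b τ c ∧ ∀ c', IsFeasible M b τ c' → ∑ i, |c i| ≤ ∑ i, |c' i|

/-- Hard thresholding: keep the entries that exceed `t`, and put zero elsewhere. -/
def hardThreshold {ι : Type*} (t : ℝ) (c : ι → ℝ) : ι → ℝ :=
  fun i => if t < c i then c i else 0

/-- The measure `(∑_q h_q δ_q) / ‖h‖₁`, where `h` is the thresholding of `c` at level `t`. -/
def recoveredMeasure {n : ℕ} (C : Finset (Sph n)) (t : ℝ) (c : C → ℝ) : Measure (Sph n) :=
  pointMeasure (fun q => hardThreshold t c q / ∑ q', |hardThreshold t c q'|)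
    (fun q : C => (q : Sph n))

/-! ### Easily approximable measures -/

/-- `max_{q ≠ q' ∈ C} ⟨q, q'⟩`. -/
def codeAlpha {n : ℕ} (C : Finset (Sph n)) : ℝ :=
  sSup {s : ℝ | ∃ q ∈ C, ∃ q' ∈ C, q ≠ q' ∧ s = sphInner q q'}

/-- `max_i min_{q ∈ C} arccos ⟨q, x_i⟩`. -/
def codeTheta {n k : ℕ} (C : Finset (Sph n)) (x : Fin k → Sph n) : ℝ :=
  ⨆ i, ⨅ q : C, sphDist (q : Sph n) (x i)

/-- A measure with the `k` atoms `x 0, …, x (k-1)` is easily approximable by the codes `C j`,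
with the sequence of degrees `d` as witness. -/
structure EasilyApproximableWith {n k : ℕ} (C : ℕ → Finset (Sph n)) (x : Fin k → Sph n)
    (d : ℕ → ℕ) : Prop where
  separated : ∀ᶠ j in atTop, ((k : ℝ) - 1) * ((1 + codeAlpha (C j)) / 2) ^ d j < √2 - 1
  close : Tendsto (fun j => ((1 + Real.cos (codeTheta (C j) x)) / 2) ^ d j) atTop (𝓝 1)

end SphereMoments

end

/-! The Kostlan-Shub-Smale variances are multinomial coefficients over `2 ^ d`, so `E[P(y) P(z)] =
((1 + ⟨y, z⟩) / 2) ^ d =: K_d(y, z)`. Writing `v(y)` for the vector of values `P_i(y) / √m`, the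
inner products `⟨v(y), v(z)⟩` are empirical versions of `K_d`. They depend on `y, z` only through
finitely many empirical covariances of coefficients, multiplied by monomials bounded by 1 on the
sphere. Chebyshev's inequality therefore makes them `δ`-close to `K_d` uniformly in `y, z` once `m`
is large (`exists_sampleSize`). With errors `1 / (j + 1)` and failure probabilities `2 ^ (-j)`,
Borel-Cantelli gives this almost surely for all large `j`, whatever the dependence between different
`j`.

The rest is deterministic. Let `q_i` be a code point nearest to `x_i`. By condition 2, `K_d(q_i,
x_i)` tends to 1, so `∑ g_i v(q_i)` is within some `τ_j → 0` of the moment vector. Hence the program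
is feasible, and its optima have `ℓ¹` norm at most `∑ g_i = 1` (`exists_isFeasible`). The degrees
that separate the increasingly dense code also kill the kernel between the distinct atoms, so the
`v(q_i)` are nearly orthonormal (`tendsto_kssKernel_zero`). Condition 1 bounds the total correlation
of any other code point with the `v(q_i)` by 9/10. Then `∑ v(q_i)` acts as a dual certificate, and
any optimum is close to `g` on the `q_i` and to 0 elsewhere (`abs_sub_le_of_nearly_orthonormal`).
Thresholding at half the smallest weight isolates the `q_i`, and an explicit coupling bounds the
Wasserstein distance. -/

namespace SphereMoments

/-! ### The covariance kernel of Kostlan-Shub-Smale polynomials -/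

/-- The covariance kernel `((1 + ⟨y, z⟩) / 2) ^ d` of Kostlan-Shub-Smale polynomials. -/
noncomputable def kssKernel {n : ℕ} (d : ℕ) (y z : Sph n) : ℝ := ((1 + sphInner y z) / 2) ^ d

theorem sphInner_self {n : ℕ} (y : Sph n) : sphInner y y = 1 := by
  simp [sphInner]

theorem abs_sphInner_le_one {n : ℕ} (y z : Sph n) : |sphInner y z| ≤ 1 := by
  have h := abs_real_inner_le_norm (y : EuclideanSpace ℝ (Fin n)) (z : EuclideanSpace ℝ (Fin n))
  simpa [sphInner] using h

theorem sphInner_eq_sum {n : ℕ} (y z : Sph n) :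
    sphInner y z = ∑ r, (y : EuclideanSpace ℝ (Fin n)) r * (z : EuclideanSpace ℝ (Fin n)) r := by
  simp [sphInner, PiLp.inner_apply, mul_comm]

theorem sphInner_lt_one {n : ℕ} {y z : Sph n} (h : y ≠ z) : sphInner y z < 1 :=
  inner_lt_one_iff_real_of_norm_eq_one (by simp) (by simp) |>.2 fun h' => h (Subtype.ext h')

theorem kssKernel_base_nonneg {n : ℕ} (y z : Sph n) : 0 ≤ (1 + sphInner y z) / 2 := by
  have := (abs_le.1 (abs_sphInner_le_one y z)).1
  linarith

theorem kssKernel_nonneg {n d : ℕ} (y z : Sph n) : 0 ≤ kssKernel d y z :=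
  pow_nonneg (kssKernel_base_nonneg y z) d

theorem kssKernel_self {n d : ℕ} (y : Sph n) : kssKernel d y y = 1 := by
  simp [kssKernel, sphInner_self]

/-- The multinomial theorem for `(1 + ∑ r, t r) ^ d`. -/
theorem one_add_sum_pow {n : ℕ} (d : ℕ) (t : Fin n → ℝ) :
    (1 + ∑ r, t r) ^ d = ∑ α ∈ multiIndices n d,
      (d.factorial : ℝ) / (((d - ∑ r, α r).factorial : ℝ) * ∏ r, ((α r).factorial : ℝ)) *
        ∏ r, t r ^ α r := by
  have hmaps : ∀ α ∈ multiIndices n d, ∑ r, α r ∈ Finset.range (d + 1) := fun α hα =>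
    Finset.mem_range.2 (Nat.lt_succ_of_le (mem_multiIndices.1 hα))
  -- Group the multi-indices by total degree: the binomial theorem in `∑ r, t r` supplies the factor
  -- for the slack `d - |α|`, and each fibre is an ordinary multinomial expansion.
  rw [add_comm, add_pow, ← Finset.sum_fiberwise_of_maps_to hmaps]
  refine Finset.sum_congr rfl fun m hm => ?_
  have hmd : m ≤ d := Nat.lt_succ_iff.1 (Finset.mem_range.1 hm)
  have hfilter : (multiIndices n d).filter (fun α => ∑ r, α r = m) =
      Finset.piAntidiag Finset.univ m := by
    ext α
    simp only [Finset.mem_filter, mem_multiIndices, Finset.mem_piAntidiag, Finset.mem_univ,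
      implies_true, and_true]
    exact ⟨fun h => h.2, fun h => ⟨h.le.trans hmd, h⟩⟩
  rw [hfilter, Finset.sum_pow_eq_sum_piAntidiag, one_pow, mul_one, Finset.sum_mul]
  refine Finset.sum_congr rfl fun α hα => ?_
  have hα : ∑ r, α r = m := (Finset.mem_piAntidiag.1 hα).1
  have hprod : (∏ r, ((α r).factorial : ℝ)) ≠ 0 :=
    Finset.prod_ne_zero_iff.2 fun r _ => Nat.cast_ne_zero.2 (Nat.factorial_ne_zero _)
  have hmult : (∏ r, ((α r).factorial : ℝ)) * (Nat.multinomial Finset.univ α : ℝ) =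
      m.factorial := by
    have := Nat.multinomial_spec (Finset.univ : Finset (Fin n)) α
    rw [hα] at this
    exact_mod_cast this
  have hchoose : (d.choose m : ℝ) * m.factorial * (d - m).factorial = d.factorial := by
    exact_mod_cast Nat.choose_mul_factorial_mul_factorial hmd
  have hdm : ((d - m).factorial : ℝ) ≠ 0 := Nat.cast_ne_zero.2 (Nat.factorial_ne_zero _)
  rw [hα, ← hchoose, ← hmult]
  field_simp

/-- The left side is the covariance of the polynomial values at `y` and `z`; this is the multinomial
expansion with `t r = y_r z_r`. -/
theorem sum_kssVariance_mul {n d : ℕ} (y z : Sph n) :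
    ∑ α : multiIndices n d, (kssVariance d (α : Fin n → ℕ) : ℝ) *
      ((∏ r, ((y : EuclideanSpace ℝ (Fin n)) r) ^ ((α : Fin n → ℕ) r)) *
        ∏ r, ((z : EuclideanSpace ℝ (Fin n)) r) ^ ((α : Fin n → ℕ) r)) = kssKernel d y z := by
  rw [Finset.sum_coe_sort (multiIndices n d) (fun α => (kssVariance d α : ℝ) *
    ((∏ r, ((y : EuclideanSpace ℝ (Fin n)) r) ^ (α r)) *
      ∏ r, ((z : EuclideanSpace ℝ (Fin n)) r) ^ (α r))), kssKernel, sphInner_eq_sum, div_pow,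
    one_add_sum_pow, Finset.sum_div]
  refine Finset.sum_congr rfl fun α _ => ?_
  simp only [kssVariance, NNReal.coe_div, NNReal.coe_mul, NNReal.coe_natCast, NNReal.coe_prod,
    NNReal.coe_pow, NNReal.coe_ofNat, mul_pow, Finset.prod_mul_distrib]
  ring

theorem abs_monomial_le_one {n : ℕ} (y : Sph n) (α : Fin n → ℕ) :
    |∏ r, ((y : EuclideanSpace ℝ (Fin n)) r) ^ (α r)| ≤ 1 := by
  rw [Finset.abs_prod]
  refine Finset.prod_le_one (fun _ _ => abs_nonneg _) fun r _ => ?_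
  rw [abs_pow]
  refine pow_le_one₀ (abs_nonneg _) ?_
  have h := PiLp.norm_apply_le (y : EuclideanSpace ℝ (Fin n)) r
  simpa using h

/-! ### Concentration of the empirical kernel -/

/-- The vector of the values at `y` of the normalized polynomials. -/
noncomputable def measVec {n d m : ℕ} (a : Fin m → multiIndices n d → ℝ) (y : Sph n) :
    EuclideanSpace ℝ (Fin m) :=
  WithLp.toLp 2 fun i => measFun a i y

/-- The empirical covariance of the coefficients. -/
noncomputable def empCov {n d m : ℕ} (a : Fin m → multiIndices n d → ℝ)
    (α β : multiIndices n d) : ℝ :=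
  (∑ i, a i α * a i β) / m

theorem inner_measVec {n d m : ℕ} (a : Fin m → multiIndices n d → ℝ) (y z : Sph n) :
    inner ℝ (measVec a y) (measVec a z) = ∑ α, ∑ β, empCov a α β *
      ((∏ r, ((y : EuclideanSpace ℝ (Fin n)) r) ^ ((α : Fin n → ℕ) r)) *
        ∏ r, ((z : EuclideanSpace ℝ (Fin n)) r) ^ ((β : Fin n → ℕ) r)) := by
  have hm : √(m : ℝ) * √(m : ℝ) = m := Real.mul_self_sqrt (Nat.cast_nonneg m)
  have hterm : ∀ i, measFun a i y * measFun a i z = ∑ α, ∑ β, a i α * a i β / m *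
      ((∏ r, ((y : EuclideanSpace ℝ (Fin n)) r) ^ ((α : Fin n → ℕ) r)) *
        ∏ r, ((z : EuclideanSpace ℝ (Fin n)) r) ^ ((β : Fin n → ℕ) r)) := by
    intro i
    rw [measFun, measFun, div_mul_div_comm, hm, polyEval, polyEval, Finset.sum_mul_sum,
      Finset.sum_div]
    refine Finset.sum_congr rfl fun α _ => ?_
    rw [Finset.sum_div]
    exact Finset.sum_congr rfl fun β _ => by ring
  have hin : inner ℝ (measVec a y) (measVec a z) = ∑ i, measFun a i y * measFun a i z := by
    simp [measVec, PiLp.inner_apply, mul_comm]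
  rw [hin, Finset.sum_congr rfl fun i _ => hterm i, Finset.sum_comm]
  refine Finset.sum_congr rfl fun α _ => ?_
  rw [Finset.sum_comm]
  refine Finset.sum_congr rfl fun β _ => ?_
  rw [empCov, Finset.sum_div, Finset.sum_mul]

/-- Reduces uniform control over a continuum of pairs `y, z` to finitely many coefficient
covariances, so no net on the sphere is needed. -/
theorem abs_inner_measVec_sub_kssKernel_le {n d m : ℕ} (a : Fin m → multiIndices n d → ℝ) {ε : ℝ}
    (h : ∀ α β : multiIndices n d, |empCov a α β -
      if α = β then (kssVariance d (α : Fin n → ℕ) : ℝ) else 0| ≤ ε) (y z : Sph n) :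
    |inner ℝ (measVec a y) (measVec a z) - kssKernel d y z| ≤
      (multiIndices n d).card ^ 2 * ε := by
  have hK : kssKernel d y z = ∑ α : multiIndices n d, ∑ β : multiIndices n d,
      (if α = β then (kssVariance d (α : Fin n → ℕ) : ℝ) else 0) *
      ((∏ r, ((y : EuclideanSpace ℝ (Fin n)) r) ^ ((α : Fin n → ℕ) r)) *
        ∏ r, ((z : EuclideanSpace ℝ (Fin n)) r) ^ ((β : Fin n → ℕ) r)) := by
    rw [← sum_kssVariance_mul]
    refine Finset.sum_congr rfl fun α _ => ?_
    simp only [ite_mul, zero_mul, Finset.sum_ite_eq, Finset.mem_univ, if_true]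
  rw [inner_measVec, hK, ← Finset.sum_sub_distrib]
  have hbound : ∀ α β : multiIndices n d, |empCov a α β *
      ((∏ r, ((y : EuclideanSpace ℝ (Fin n)) r) ^ ((α : Fin n → ℕ) r)) *
        ∏ r, ((z : EuclideanSpace ℝ (Fin n)) r) ^ ((β : Fin n → ℕ) r)) -
      (if α = β then (kssVariance d (α : Fin n → ℕ) : ℝ) else 0) *
      ((∏ r, ((y : EuclideanSpace ℝ (Fin n)) r) ^ ((α : Fin n → ℕ) r)) *
        ∏ r, ((z : EuclideanSpace ℝ (Fin n)) r) ^ ((β : Fin n → ℕ) r))| ≤ ε := by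
    intro α β
    rw [← sub_mul, abs_mul, abs_mul]
    have h1 := abs_monomial_le_one y (α : Fin n → ℕ)
    have h2 := abs_monomial_le_one z (β : Fin n → ℕ)
    have h3 := mul_le_one₀ h1 (abs_nonneg _) h2
    have h4 := h α β
    calc _ ≤ |empCov a α β - if α = β then (kssVariance d (α : Fin n → ℕ) : ℝ) else 0| * 1 :=
          mul_le_mul_of_nonneg_left h3 (abs_nonneg _)
      _ ≤ ε := by rwa [mul_one]
  refine (Finset.abs_sum_le_sum_abs _ _).trans ?_
  calc _ ≤ ∑ _α : multiIndices n d, ∑ _β : multiIndices n d, ε := by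
        refine Finset.sum_le_sum fun α _ => ?_
        rw [← Finset.sum_sub_distrib]
        exact (Finset.abs_sum_le_sum_abs _ _).trans (Finset.sum_le_sum fun β _ => hbound α β)
    _ = _ := by
        simp only [Finset.sum_const, Finset.card_univ, Fintype.card_coe, nsmul_eq_mul]
        ring

/-- The fourth moment of the centred Gaussian with variance `v`. -/
noncomputable def gaussianFourth (v : ℝ≥0) : ℝ := ∫ x, x ^ 4 ∂gaussianReal 0 v

theorem memLp_of_hasLaw_gaussianReal {Ω : Type*} [MeasurableSpace Ω] {P : Measure Ω}
    {X : Ω → ℝ} {v : ℝ≥0} (h : HasLaw X (gaussianReal 0 v) P) (p : ℝ≥0) : MemLp X p P := by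
  have h1 : MemLp id p (P.map X) := by
    rw [h.map_eq]; exact memLp_id_gaussianReal p
  exact (memLp_map_measure_iff aestronglyMeasurable_id h.aemeasurable).1 h1

/-- The inequality `X²Y² ≤ X⁴ + Y⁴` requires no independence, so the diagonal case `X = Y` is
covered too. Only finiteness of the bound matters later. -/
theorem variance_mul_le_of_gaussian {Ω : Type*} [MeasurableSpace Ω] {P : Measure Ω}
    [IsProbabilityMeasure P] {X Y : Ω → ℝ} {v w : ℝ≥0} (hX : HasLaw X (gaussianReal 0 v) P)
    (hY : HasLaw Y (gaussianReal 0 w) P) :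
    Var[X * Y; P] ≤ gaussianFourth v + gaussianFourth w := by
  have hint : ∀ {Z : Ω → ℝ} {u : ℝ≥0}, HasLaw Z (gaussianReal 0 u) P →
      Integrable (fun ω => Z ω ^ 4) P ∧ ∫ ω, Z ω ^ 4 ∂P = gaussianFourth u := by
    intro Z u hZ
    refine ⟨?_, ?_⟩
    · have h := (memLp_of_hasLaw_gaussianReal hZ 4).integrable_norm_pow (p := 4) (by norm_num)
      refine h.congr (ae_of_all _ fun ω => ?_)
      simp only [Real.norm_eq_abs]
      exact Even.pow_abs (by decide) _
    · have h := hZ.integral_comp (f := fun x : ℝ => x ^ 4)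
        (by fun_prop)
      exact h
  obtain ⟨hX1, hX2⟩ := hint hX
  obtain ⟨hY1, hY2⟩ := hint hY
  refine (variance_le_expectation_sq
    (hX.aemeasurable.mul hY.aemeasurable).aestronglyMeasurable).trans ?_
  rw [← hX2, ← hY2, ← integral_add hX1 hY1]
  refine integral_mono_of_nonneg (ae_of_all _ fun ω => ?_) (hX1.add hY1) (ae_of_all _ fun ω => ?_)
  · simp only [Pi.pow_apply]; positivity
  · simp only [Pi.pow_apply, Pi.mul_apply]
    nlinarith [sq_nonneg (X ω ^ 2 - Y ω ^ 2), sq_nonneg (X ω ^ 2), sq_nonneg (Y ω ^ 2)]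

theorem integral_mul_of_isKSSSample {n d m : ℕ} {Ω : Type*} [MeasurableSpace Ω] {P : Measure Ω}
    [IsProbabilityMeasure P] {A : Fin m → multiIndices n d → Ω → ℝ} (hA : IsKSSSample P A)
    (i : Fin m) (α β : multiIndices n d) :
    ∫ ω, A i α ω * A i β ω ∂P =
      if α = β then (kssVariance d (α : Fin n → ℕ) : ℝ) else 0 := by
  have hmean : ∀ γ, ∫ ω, A i γ ω ∂P = 0 := fun γ => by
    rw [(hA.hasLaw i γ).integral_eq]; simp
  split_ifs with h
  · subst h
    have h1 := (hA.hasLaw i α).variance_eq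
    rw [variance_id_gaussianReal,
      variance_of_integral_eq_zero (hA.hasLaw i α).aemeasurable (hmean α)] at h1
    rw [← h1]
    exact integral_congr_ae (ae_of_all _ fun ω => by simp [pow_two])
  · have hind : IndepFun (A i α) (A i β) P :=
      hA.indep.indepFun (i := (i, α)) (j := (i, β)) fun h' => h (congrArg Prod.snd h')
    have h1 := hind.integral_mul_eq_mul_integral
      (hA.hasLaw i α).aemeasurable.aestronglyMeasurable
      (hA.hasLaw i β).aemeasurable.aestronglyMeasurable
    rw [hmean, zero_mul] at h1
    exact h1

/-- Chebyshev's inequality for the empirical covariance of the coefficients. -/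
theorem measure_empCov_le {n d m : ℕ} (hm : 0 < m) {Ω : Type*} [MeasurableSpace Ω] {P : Measure Ω}
    [IsProbabilityMeasure P] {A : Fin m → multiIndices n d → Ω → ℝ} (hA : IsKSSSample P A)
    (α β : multiIndices n d) {ε : ℝ} (hε : 0 < ε) :
    P {ω | ε ≤ |empCov (fun i γ => A i γ ω) α β -
      if α = β then (kssVariance d (α : Fin n → ℕ) : ℝ) else 0|} ≤
      ENNReal.ofReal ((gaussianFourth (kssVariance d (α : Fin n → ℕ)) +
        gaussianFourth (kssVariance d (β : Fin n → ℕ))) / (m * ε ^ 2)) := by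
  set X : Fin m → Ω → ℝ := fun i => A i α * A i β with hXdef
  have hmR : (0 : ℝ) < m := Nat.cast_pos.2 hm
  have hmem : ∀ i, MemLp (X i) 2 P := by
    intro i
    have : ENNReal.HolderTriple ((4 : ℝ≥0) : ℝ≥0∞) ((4 : ℝ≥0) : ℝ≥0∞) 2 := by
      refine ⟨?_⟩
      have h4 : ((4 : ℝ≥0) : ℝ≥0∞) = 2 * 2 := by norm_num
      rw [h4, ENNReal.mul_inv (by simp) (by simp), ← mul_add, ENNReal.inv_two_add_inv_two, mul_one]
    exact (memLp_of_hasLaw_gaussianReal (hA.hasLaw i β) 4).mul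
      (memLp_of_hasLaw_gaussianReal (hA.hasLaw i α) 4)
  have hind : ((Finset.univ : Finset (Fin m)) : Set (Fin m)).Pairwise
      fun i j => IndepFun (X i) (X j) P := by
    intro i _ j _ hij
    have hne : ∀ γ γ' : multiIndices n d, (i, γ) ≠ (j, γ') := fun γ γ' h =>
      hij (congrArg Prod.fst h)
    have h := hA.indep.indepFun_prodMk_prodMk₀ (fun p => (hA.hasLaw p.1 p.2).aemeasurable)
      (i, α) (i, β) (j, α) (j, β) (hne _ _) (hne _ _) (hne _ _) (hne _ _)
    exact h.comp (measurable_fst.mul measurable_snd) (measurable_fst.mul measurable_snd)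
  have hvar : Var[∑ i, X i; P] ≤ m * (gaussianFourth (kssVariance d (α : Fin n → ℕ)) +
        gaussianFourth (kssVariance d (β : Fin n → ℕ))) := by
    rw [IndepFun.variance_sum (fun i _ => hmem i) hind]
    refine (Finset.sum_le_card_nsmul _ _ _ fun i _ =>
      variance_mul_le_of_gaussian (hA.hasLaw i α) (hA.hasLaw i β)).trans_eq ?_
    rw [Finset.card_univ, Fintype.card_fin, nsmul_eq_mul]
  have hint : ∫ ω, (∑ i, X i) ω ∂P =
      m * if α = β then (kssVariance d (α : Fin n → ℕ) : ℝ) else 0 := by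
    simp only [Finset.sum_apply]
    rw [integral_finsetSum _ fun i _ => (hmem i).integrable (by norm_num)]
    simp only [hXdef, Pi.mul_apply, integral_mul_of_isKSSSample hA, Finset.sum_const,
      Finset.card_univ, Fintype.card_fin, nsmul_eq_mul]
  have hcheb := meas_ge_le_variance_div_sq (memLp_finsetSum' Finset.univ fun i _ => hmem i)
    (mul_pos hmR hε)
  refine le_trans (measure_mono fun ω hω => ?_) (hcheb.trans (ENNReal.ofReal_le_ofReal ?_))
  · simp only [Set.mem_ofPred_eq] at hω ⊢
    rw [hint]
    have : (∑ i, X i) ω - m * (if α = β then (kssVariance d (α : Fin n → ℕ) : ℝ) else 0) =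
        m * (empCov (fun i γ => A i γ ω) α β -
          if α = β then (kssVariance d (α : Fin n → ℕ) : ℝ) else 0) := by
      simp only [empCov, Finset.sum_apply, hXdef, Pi.mul_apply]
      field_simp
    rw [this, abs_mul, abs_of_pos hmR]
    exact mul_le_mul_of_nonneg_left hω hmR.le
  · rw [div_le_div_iff₀ (by positivity) (by positivity)]
    calc _ ≤ (m * (gaussianFourth (kssVariance d (α : Fin n → ℕ)) +
        gaussianFourth (kssVariance d (β : Fin n → ℕ)))) * (m * ε ^ 2) :=
          mul_le_mul_of_nonneg_right hvar (by positivity)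
      _ = _ := by ring

/-- For a suitable sample size, the empirical kernel is uniformly close to the covariance kernel,
except on an event of small probability. -/
theorem exists_sampleSize (n d : ℕ) {δ η : ℝ} (hδ : 0 < δ) (hη : 0 < η) :
    ∃ m : ℕ, 0 < m ∧ ∀ (Ω : Type*) [MeasurableSpace Ω] (P : Measure Ω) [IsProbabilityMeasure P]
      (A : Fin m → multiIndices n d → Ω → ℝ), IsKSSSample P A →
      P {ω | ¬ ∀ y z : Sph n, |inner ℝ (measVec (fun i γ => A i γ ω) y)
        (measVec (fun i γ => A i γ ω) z) - kssKernel d y z| ≤ δ} ≤ ENNReal.ofReal η := by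
  set N : ℝ := ((multiIndices n d).card : ℝ) with hN
  -- There are `N²` pairs of multi-indices, each contributing at most `ε`; the `+ 1` keeps the
  -- denominator visibly positive.
  set ε : ℝ := δ / (N ^ 2 + 1) with hεdef
  have hε : 0 < ε := by positivity
  set S : ℝ := ∑ α : multiIndices n d, ∑ β : multiIndices n d,
    (gaussianFourth (kssVariance d (α : Fin n → ℕ)) +
      gaussianFourth (kssVariance d (β : Fin n → ℕ))) with hS
  -- The union bound over all pairs costs `S / (m * ε ^ 2)`, which this `m` brings below `η`.
  obtain ⟨m, hm⟩ := exists_nat_gt (max 0 (S / (η * ε ^ 2)))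
  have hm0 : 0 < m := by exact_mod_cast (le_max_left _ _).trans_lt hm
  have hmR : (0 : ℝ) < m := Nat.cast_pos.2 hm0
  refine ⟨m, hm0, ?_⟩
  intro Ω _ P _ A hA
  have hfourth : ∀ v : ℝ≥0, 0 ≤ gaussianFourth v := fun v =>
    integral_nonneg fun x => by positivity
  have hsub : {ω | ¬ ∀ y z : Sph n, |inner ℝ (measVec (fun i γ => A i γ ω) y)
        (measVec (fun i γ => A i γ ω) z) - kssKernel d y z| ≤ δ} ⊆
      ⋃ α : multiIndices n d, ⋃ β : multiIndices n d,
        {ω | ε ≤ |empCov (fun i γ => A i γ ω) α β -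
          if α = β then (kssVariance d (α : Fin n → ℕ) : ℝ) else 0|} := by
    intro ω hω
    by_contra hcon
    simp only [Set.mem_iUnion, Set.mem_ofPred_eq, not_exists, not_le] at hcon
    refine hω fun y z => (abs_inner_measVec_sub_kssKernel_le _
      (fun α β => (hcon α β).le) y z).trans ?_
    rw [hεdef, ← hN, mul_div_assoc', div_le_iff₀ (by positivity)]
    nlinarith
  refine (measure_mono hsub).trans ((measure_iUnion_fintype_le _ _).trans ?_)
  calc _ ≤ ∑ α : multiIndices n d, ∑ β : multiIndices n d,
        ENNReal.ofReal ((gaussianFourth (kssVariance d (α : Fin n → ℕ)) +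
        gaussianFourth (kssVariance d (β : Fin n → ℕ))) / (m * ε ^ 2)) :=
        Finset.sum_le_sum fun α _ => (measure_iUnion_fintype_le _ _).trans
          (Finset.sum_le_sum fun β _ => measure_empCov_le hm0 hA α β hε)
    _ = ENNReal.ofReal (S / (m * ε ^ 2)) := by
        have hnn : ∀ α β : multiIndices n d, 0 ≤
            (gaussianFourth (kssVariance d (α : Fin n → ℕ)) +
              gaussianFourth (kssVariance d (β : Fin n → ℕ))) / (m * ε ^ 2) := fun α β =>
          div_nonneg (add_nonneg (hfourth _) (hfourth _)) (by positivity)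
        rw [hS, Finset.sum_div,
          ENNReal.ofReal_sum_of_nonneg fun α _ => by
            rw [Finset.sum_div]; exact Finset.sum_nonneg fun β _ => hnn α β]
        refine Finset.sum_congr rfl fun α _ => ?_
        rw [Finset.sum_div, ENNReal.ofReal_sum_of_nonneg fun β _ => hnn α β]
    _ ≤ ENNReal.ofReal η := by
        refine ENNReal.ofReal_le_ofReal ?_
        have h := (le_max_right _ _).trans_lt hm
        rw [div_lt_iff₀ (by positivity)] at h
        rw [div_le_iff₀ (by positivity)]
        nlinarith

/-! ### The convex program -/

theorem exists_isL1Optimum {m : ℕ} {ι : Type*} [Fintype ι] {M : Matrix (Fin m) ι ℝ}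
    {b : Fin m → ℝ} {τ : ℝ} (h : ∃ c, IsFeasible M b τ c) : ∃ c, IsL1Optimum M b τ c := by
  obtain ⟨c₀, hc₀⟩ := h
  have hcont : Continuous fun c : ι → ℝ => ‖WithLp.toLp 2 (M *ᵥ c - b)‖ :=
    ((PiLp.continuous_toLp 2 _).comp
      ((Continuous.matrix_mulVec continuous_const continuous_id).sub continuous_const)).norm
  have hl1 : Continuous fun c : ι → ℝ => ∑ i, |c i| := by fun_prop
  -- Cutting the feasible set at the norm of one feasible point makes it compact without losing any
  -- competitor.
  set K : Set (ι → ℝ) := {c | IsFeasible M b τ c} ∩ {c | ∑ i, |c i| ≤ ∑ i, |c₀ i|} with hK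
  have hclosed : IsClosed K :=
    (isClosed_le hcont continuous_const).inter (isClosed_le hl1 continuous_const)
  have hbdd : Bornology.IsBounded K := by
    refine (Metric.isBounded_closedBall (x := (0 : ι → ℝ)) (r := ∑ i, |c₀ i|)).subset fun c hc => ?_
    rw [mem_closedBall_zero_iff, pi_norm_le_iff_of_nonneg (by positivity)]
    exact fun i => (Finset.single_le_sum (f := fun i => |c i|) (fun _ _ => abs_nonneg _)
      (Finset.mem_univ i)).trans hc.2
  obtain ⟨c, hc, hmin⟩ := (Metric.isCompact_of_isClosed_isBounded hclosed hbdd).exists_isMinOn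
    ⟨c₀, hc₀, le_refl (∑ i, |c₀ i|)⟩ hl1.continuousOn
  refine ⟨c, hc.1, fun c' hc' => ?_⟩
  by_cases hle : ∑ i, |c' i| ≤ ∑ i, |c₀ i|
  · exact hmin ⟨hc', hle⟩
  · exact hc.2.trans (not_le.1 hle).le

theorem sum_eq_sum_add_sum_compl_image {ι κ M : Type*} [Fintype ι] [DecidableEq ι] [Fintype κ]
    [AddCommMonoid M] {q : κ → ι} (hq : Function.Injective q) (f : ι → M) :
    ∑ p, f p = ∑ i, f (q i) + ∑ p ∈ (Finset.univ.image q)ᶜ, f p := by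
  rw [← Finset.sum_add_sum_compl (Finset.univ.image q), Finset.sum_image fun _ _ _ _ h => hq h]

/-- Stability of `ℓ¹` minimization: if the vectors `v (q i)` are nearly orthonormal and no other
vector `v p` is strongly correlated with their sum, then a vector of `ℓ¹` norm at most one which
nearly reproduces `∑ i, g i • v (q i)` has coefficients close to `g` on the range of `q`, and close
to zero elsewhere. -/
theorem abs_sub_le_of_nearly_orthonormal {V : Type*} [NormedAddCommGroup V]
    [InnerProductSpace ℝ V] {ι : Type*} [Fintype ι] {k : ℕ} (v : ι → V)
    {q : Fin k → ι} (hq : Function.Injective q) {c : ι → ℝ} {g : Fin k → ℝ} {b : V} {τ σ : ℝ}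
    (hc : ‖∑ p, c p • v p - b‖ ≤ τ) (hgb : ‖∑ i, g i • v (q i) - b‖ ≤ τ)
    (hnorm : ∀ i, ‖v (q i)‖ ≤ 2) (hg : ∀ i, 0 ≤ g i) (hg_sum : ∑ i, g i = 1)
    (hc_sum : ∑ p, |c p| ≤ 1)
    (hin : ∀ i i', |inner ℝ (v (q i')) (v (q i)) - (if i' = i then 1 else 0)| ≤ σ)
    (hout : ∀ p, p ∉ Set.range q → ∑ i, |inner ℝ (v p) (v (q i))| ≤ 9 / 10) :
    (∀ i, |c (q i) - g i| ≤ 11 * (k * (4 * τ + 2 * σ))) ∧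
      ∀ p, p ∉ Set.range q → |c p| ≤ 11 * (k * (4 * τ + 2 * σ)) := by
  classical
  have hk : 1 ≤ k := by
    by_contra hk
    obtain rfl : k = 0 := by omega
    simp at hg_sum
  have hkR : (1 : ℝ) ≤ k := by exact_mod_cast hk
  have hτ : 0 ≤ τ := (norm_nonneg _).trans hc
  have hσ : 0 ≤ σ := (abs_nonneg _).trans (hin ⟨0, hk⟩ ⟨0, hk⟩)
  set T : Finset ι := (Finset.univ.image q)ᶜ with hT
  have hmemT : ∀ p ∈ T, p ∉ Set.range q := fun p hp => by
    simpa [hT] using hp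
  set h : Fin k → ℝ := fun i => c (q i) - g i with hh
  set L : ℝ := ∑ p ∈ T, |c p| with hL
  have hL0 : 0 ≤ L := Finset.sum_nonneg fun _ _ => abs_nonneg _
  rw [sum_eq_sum_add_sum_compl_image hq] at hc_sum
  -- Since `g` is nonnegative of mass one and `‖c‖₁ ≤ 1`, mass outside the range of `q` must be
  -- missing on it.
  have hLh : L ≤ -∑ i, h i := by
    have h1 : ∑ i, c (q i) ≤ ∑ i, |c (q i)| := Finset.sum_le_sum fun i _ => le_abs_self _
    have h2 : ∑ i, h i = ∑ i, c (q i) - 1 := by rw [hh, Finset.sum_sub_distrib, hg_sum]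
    linarith
  have hh2 : ∑ i, |h i| ≤ 2 := by
    have h1 : ∑ i, |h i| ≤ ∑ i, (|c (q i)| + g i) := Finset.sum_le_sum fun i _ =>
      (abs_sub _ _).trans (by rw [abs_of_nonneg (hg i)])
    rw [Finset.sum_add_distrib, hg_sum] at h1
    linarith
  set u : V := ∑ i, h i • v (q i) + ∑ p ∈ T, c p • v p with hu
  have hu_norm : ‖u‖ ≤ 2 * τ := by
    have : u = (∑ p, c p • v p - b) - (∑ i, g i • v (q i) - b) := by
      rw [sum_eq_sum_add_sum_compl_image hq, hu, hh]
      simp only [sub_smul, Finset.sum_sub_distrib]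
      abel
    rw [this]
    exact (norm_sub_le _ _).trans (by linarith)
  set R : Fin k → ℝ := fun i => ∑ p ∈ T, c p * inner ℝ (v p) (v (q i)) with hR
  -- Pair `u` with `v (q i)`: `4 * τ` is `‖u‖ ≤ 2 * τ` times the norm bound 2, and `2 * σ` is the
  -- Gram error weighted by `∑ |h i| ≤ 2`.
  have hmain : ∀ i, |h i + R i| ≤ 4 * τ + 2 * σ := by
    intro i
    have he : inner ℝ u (v (q i)) = ∑ i', h i' * inner ℝ (v (q i')) (v (q i)) + R i := by
      simp only [hu, hR, inner_add_left, sum_inner, real_inner_smul_left]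
    have he' : |inner ℝ u (v (q i))| ≤ 4 * τ := by
      refine (abs_real_inner_le_norm _ _).trans ?_
      nlinarith [hnorm i, norm_nonneg u, norm_nonneg (v (q i))]
    have hr : ∑ i', h i' * inner ℝ (v (q i')) (v (q i)) - h i =
        ∑ i', h i' * (inner ℝ (v (q i')) (v (q i)) - (if i' = i then 1 else 0)) := by
      simp only [mul_sub, Finset.sum_sub_distrib, mul_ite, mul_one, mul_zero, Finset.sum_ite_eq',
        Finset.mem_univ, if_true]
    have hr' : |∑ i', h i' * (inner ℝ (v (q i')) (v (q i)) - (if i' = i then 1 else 0))| ≤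
        2 * σ := by
      refine (Finset.abs_sum_le_sum_abs _ _).trans ?_
      calc _ ≤ ∑ i', |h i'| * σ := Finset.sum_le_sum fun i' _ => by
            rw [abs_mul]; exact mul_le_mul_of_nonneg_left (hin i i') (abs_nonneg _)
        _ ≤ 2 * σ := by rw [← Finset.sum_mul]; exact mul_le_mul_of_nonneg_right hh2 hσ
    rw [← hr] at hr'
    have : h i + R i = inner ℝ u (v (q i)) -
        (∑ i', h i' * inner ℝ (v (q i')) (v (q i)) - h i) := by rw [he]; ring
    rw [this]
    exact (abs_sub _ _).trans (add_le_add he' hr')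
  have hRsum : |∑ i, R i| ≤ 9 / 10 * L := by
    rw [hR, Finset.sum_comm, hL, Finset.mul_sum]
    refine (Finset.abs_sum_le_sum_abs _ _).trans (Finset.sum_le_sum fun p hp => ?_)
    rw [← Finset.mul_sum, abs_mul, mul_comm]
    exact mul_le_mul_of_nonneg_right
      ((Finset.abs_sum_le_sum_abs _ _).trans (hout p (hmemT p hp))) (abs_nonneg _)
  have hRi : ∀ i, |R i| ≤ L := by
    intro i
    refine (Finset.abs_sum_le_sum_abs _ _).trans (Finset.sum_le_sum fun p hp => ?_)
    have h1 := (Finset.single_le_sum (f := fun i => |inner ℝ (v p) (v (q i))|)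
      (fun _ _ => abs_nonneg _) (Finset.mem_univ i)).trans (hout p (hmemT p hp))
    rw [abs_mul]
    exact mul_le_of_le_one_right (abs_nonneg _) (h1.trans (by norm_num))
  have hsum : |∑ i, h i + ∑ i, R i| ≤ k * (4 * τ + 2 * σ) := by
    rw [← Finset.sum_add_distrib]
    refine (Finset.abs_sum_le_sum_abs _ _).trans
      ((Finset.sum_le_sum fun i _ => hmain i).trans_eq ?_)
    rw [Finset.sum_const, Finset.card_univ, Fintype.card_fin, nsmul_eq_mul]
  set B : ℝ := k * (4 * τ + 2 * σ) with hB
  have hB' : 4 * τ + 2 * σ ≤ B := le_mul_of_one_le_left (by positivity) hkR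
  -- Summing over `i` is pairing with the certificate `∑ v (q i)`: `L ≤ -∑ h ≤ B + (9/10) * L`. The
  -- slack 1/10 produces the factor 10, and one further `B` gives 11.
  have hLB : L ≤ 10 * B := by
    have h1 := (abs_le.1 hsum).1
    have h2 := (abs_le.1 hRsum).2
    linarith
  refine ⟨fun i => ?_, fun p hp => ?_⟩
  · have h1 := abs_le.1 (hmain i)
    have h2 := abs_le.1 (hRi i)
    exact abs_le.2 ⟨by linarith, by linarith⟩
  · have h1 : |c p| ≤ L := Finset.single_le_sum (f := fun p => |c p|)
      (fun _ _ => abs_nonneg _) (by simpa [hT] using hp)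
    have : 0 ≤ B := (by positivity : 0 ≤ 4 * τ + 2 * σ).trans hB'
    linarith

/-! ### Wasserstein distance of point measures -/

theorem sphDist_nonneg {n : ℕ} (y z : Sph n) : 0 ≤ sphDist y z := Real.arccos_nonneg _

theorem sphDist_le_pi {n : ℕ} (y z : Sph n) : sphDist y z ≤ Real.pi := Real.arccos_le_pi _

theorem isProbabilityMeasure_pointMeasure {n : ℕ} {ι : Type*} [Fintype ι] {g : ι → ℝ}
    (hg : ∀ i, 0 ≤ g i) (hg_sum : ∑ i, g i = 1) (x : ι → Sph n) :
    IsProbabilityMeasure (pointMeasure g x) := by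
  refine ⟨?_⟩
  simp only [pointMeasure, Measure.coe_finsetSum, Finset.sum_apply, Measure.smul_apply,
    measure_univ, smul_eq_mul, mul_one]
  rw [← ENNReal.ofReal_sum_of_nonneg fun i _ => hg i, hg_sum, ENNReal.ofReal_one]

theorem integral_pointMeasure {n : ℕ} {ι : Type*} [Fintype ι] {g : ι → ℝ}
    (hg : ∀ i, 0 ≤ g i) (x : ι → Sph n) (f : Sph n → ℝ) :
    ∫ y, f y ∂pointMeasure g x = ∑ i, g i * f (x i) := by
  rw [pointMeasure, integral_finsetSum_measure]
  · refine Finset.sum_congr rfl fun i _ => ?_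
    rw [integral_smul_measure, integral_dirac, ENNReal.toReal_ofReal (hg i), smul_eq_mul]
  · exact fun i _ => (integrable_dirac (by simp)).smul_measure ENNReal.ofReal_ne_top

theorem wasserstein_pointMeasure_le_of_coupling {n k : ℕ} {w g : Fin k → ℝ}
    {y x : Fin k → Sph n} {p : Fin k → Fin k → ℝ} (hp : ∀ i i', 0 ≤ p i i')
    (hfst : ∀ i, ∑ i', p i i' = w i) (hsnd : ∀ i', ∑ i, p i i' = g i') :
    wasserstein (pointMeasure w y) (pointMeasure g x) ≤
      ENNReal.ofReal (∑ i, ∑ i', p i i' * sphDist (y i) (x i') ^ 2) ^ (1 / 2 : ℝ) := by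
  refine ENNReal.rpow_le_rpow ?_ (by norm_num)
  refine (iInf₂_le (∑ i, ∑ i', ENNReal.ofReal (p i i') • Measure.dirac (y i, x i'))
    ⟨?_, ?_⟩).trans ?_
  · have hnn : ∀ i i', 0 ≤ p i i' * sphDist (y i) (x i') ^ 2 := fun i i' =>
      mul_nonneg (hp i i') (sq_nonneg _)
    rw [lintegral_finsetSum_measure,
      ENNReal.ofReal_sum_of_nonneg fun i _ => Finset.sum_nonneg fun i' _ => hnn i i']
    refine Finset.sum_le_sum fun i _ => ?_
    rw [lintegral_finsetSum_measure, ENNReal.ofReal_sum_of_nonneg fun i' _ => hnn i i']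
    refine Finset.sum_le_sum fun i' _ => ?_
    rw [lintegral_smul_measure, lintegral_dirac, smul_eq_mul, ENNReal.ofReal_mul (hp i i')]
  · rw [← Measure.mapₗ_apply_of_measurable measurable_fst]
    simp_rw [map_sum, map_smul]
    simp only [Measure.mapₗ_apply_of_measurable measurable_fst,
      Measure.map_dirac' measurable_fst, pointMeasure]
    refine Finset.sum_congr rfl fun i _ => ?_
    rw [← Finset.sum_smul, ← ENNReal.ofReal_sum_of_nonneg fun i' _ => hp i i', hfst]
  · rw [← Measure.mapₗ_apply_of_measurable measurable_snd, Finset.sum_comm]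
    simp_rw [map_sum, map_smul]
    simp only [Measure.mapₗ_apply_of_measurable measurable_snd,
      Measure.map_dirac' measurable_snd, pointMeasure]
    refine Finset.sum_congr rfl fun i' _ => ?_
    rw [← Finset.sum_smul, ← ENNReal.ofReal_sum_of_nonneg fun i _ => hp i i', hsnd]

/-- The common mass `min (w i) (g i)` moves from `y i` to `x i` at cost at most `D ^ 2`. The
leftovers have equal mass `r ≤ η` and are coupled by their normalized product, at cost at most `π ^
2` per unit mass. -/
theorem wasserstein_pointMeasure_le {n k : ℕ} {w g : Fin k → ℝ} {y x : Fin k → Sph n}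
    (hw : ∀ i, 0 ≤ w i) (hg : ∀ i, 0 ≤ g i) (hw_sum : ∑ i, w i = 1) (hg_sum : ∑ i, g i = 1)
    {D η : ℝ} (hD : ∀ i, sphDist (y i) (x i) ≤ D) (hη : ∑ i, |w i - g i| ≤ η) :
    wasserstein (pointMeasure w y) (pointMeasure g x) ≤
      ENNReal.ofReal (D ^ 2 + Real.pi ^ 2 * η) ^ (1 / 2 : ℝ) := by
  set s : Fin k → ℝ := fun i => min (w i) (g i) with hs
  have hsw : ∀ i, 0 ≤ w i - s i := fun i => sub_nonneg.2 (min_le_left _ _)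
  have hsg : ∀ i, 0 ≤ g i - s i := fun i => sub_nonneg.2 (min_le_right _ _)
  have hs0 : ∀ i, 0 ≤ s i := fun i => le_min (hw i) (hg i)
  set r : ℝ := ∑ i, (w i - s i) with hr
  have hr' : ∑ i, (g i - s i) = r := by
    rw [hr, Finset.sum_sub_distrib, Finset.sum_sub_distrib, hw_sum, hg_sum]
  have hr0 : 0 ≤ r := Finset.sum_nonneg fun i _ => hsw i
  have hrη : r ≤ η := by
    refine le_trans (Finset.sum_le_sum fun i _ => ?_) hη
    rw [hs]
    rcases le_total (w i) (g i) with h | h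
    · simp [min_eq_left h]
    · simp [min_eq_right h, le_abs_self]
  -- For `r = 0` the division yields 0, but then `a = 0` as well, so the coupling needs no case
  -- split.
  have hcancel : ∀ a : ℝ, 0 ≤ a → a ≤ r → a * r / r = a := by
    intro a ha har
    rcases eq_or_ne r 0 with h | h
    · rw [h] at har; simp [le_antisymm har ha]
    · field_simp
  have hswr : ∀ i, w i - s i ≤ r := fun i =>
    Finset.single_le_sum (f := fun i => w i - s i) (fun i _ => hsw i) (Finset.mem_univ i)
  have hsgr : ∀ i, g i - s i ≤ r := fun i => hr' ▸
    Finset.single_le_sum (f := fun i => g i - s i) (fun i _ => hsg i) (Finset.mem_univ i)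
  set p : Fin k → Fin k → ℝ := fun i i' =>
    (if i = i' then s i else 0) + (w i - s i) * (g i' - s i') / r with hp
  have hrest : ∀ i i', 0 ≤ (w i - s i) * (g i' - s i') / r := fun i i' =>
    div_nonneg (mul_nonneg (hsw i) (hsg i')) hr0
  refine (wasserstein_pointMeasure_le_of_coupling (p := p) ?_ ?_ ?_).trans ?_
  · intro i i'
    refine add_nonneg ?_ (hrest i i')
    split_ifs
    exacts [hs0 i, le_rfl]
  · intro i
    rw [hp, Finset.sum_add_distrib, ← Finset.sum_div, ← Finset.mul_sum, hr',
      hcancel _ (hsw i) (hswr i)]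
    simp
  · intro i'
    rw [hp, Finset.sum_add_distrib, ← Finset.sum_div, ← Finset.sum_mul, ← hr, mul_comm r,
      hcancel _ (hsg i') (hsgr i')]
    simp
  · refine ENNReal.rpow_le_rpow (ENNReal.ofReal_le_ofReal ?_) (by norm_num)
    calc _ ≤ ∑ i, ∑ i', ((if i = i' then s i * D ^ 2 else 0) +
          (w i - s i) * (g i' - s i') / r * Real.pi ^ 2) := by
          refine Finset.sum_le_sum fun i _ => Finset.sum_le_sum fun i' _ => ?_
          rw [hp, add_mul]
          refine add_le_add ?_ (mul_le_mul_of_nonneg_left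
            (pow_le_pow_left₀ (sphDist_nonneg _ _) (sphDist_le_pi _ _) 2) (hrest i i'))
          split_ifs with h
          · subst h
            exact mul_le_mul_of_nonneg_left (pow_le_pow_left₀ (sphDist_nonneg _ _) (hD i) 2) (hs0 i)
          · simp
      _ = (∑ i, s i) * D ^ 2 + r * r / r * Real.pi ^ 2 := by
          simp only [Finset.sum_add_distrib, Finset.sum_ite_eq, Finset.mem_univ, if_true,
            ← Finset.sum_mul, ← Finset.sum_div, ← Finset.mul_sum, hr', ← hr]
      _ ≤ D ^ 2 + Real.pi ^ 2 * η := by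
          rw [hcancel r hr0 le_rfl]
          have h1 : ∑ i, s i ≤ 1 := hw_sum ▸ Finset.sum_le_sum fun i _ => min_le_left _ _
          have h2 : (∑ i, s i) * D ^ 2 ≤ D ^ 2 := mul_le_of_le_one_left (sq_nonneg D) h1
          have h3 : r * Real.pi ^ 2 ≤ η * Real.pi ^ 2 :=
            mul_le_mul_of_nonneg_right hrη (sq_nonneg _)
          linarith

/-! ### Thresholding -/

/-- If `c` is close to the vector with the entries `g i` at the pairwise distinct indices `q i` and
zeros elsewhere, then the recovered measure is close to `∑ i, g i • δ_{x i}`. -/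
theorem recoveredMeasure_close {n k : ℕ} {C : Finset (Sph n)} {c : C → ℝ} {g : Fin k → ℝ}
    {x : Fin k → Sph n} {q : Fin k → C} (hq : Function.Injective q) (hg : ∀ i, 0 < g i)
    (hg_sum : ∑ i, g i = 1) {t η D : ℝ} (htg : ∀ i, 2 * t ≤ g i) (hηt : η < t)
    (hηk : k * η ≤ 1 / 2) (hin : ∀ i, |c (q i) - g i| ≤ η)
    (hout : ∀ p, p ∉ Set.range q → |c p| ≤ η) (hD : ∀ i, sphDist (q i : Sph n) (x i) ≤ D) :
    IsProbabilityMeasure (recoveredMeasure C t c) ∧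
      wasserstein (recoveredMeasure C t c) (pointMeasure g x) ≤
        ENNReal.ofReal (D ^ 2 + Real.pi ^ 2 * (2 * k * (k + 1) * η)) ^ (1 / 2 : ℝ) := by
  classical
  have hk : 1 ≤ k := by
    by_contra hk
    obtain rfl : k = 0 := by omega
    simp at hg_sum
  have hη0 : 0 ≤ η := (abs_nonneg _).trans (hin ⟨0, hk⟩)
  have hhq : ∀ i, hardThreshold t c (q i) = c (q i) := by
    intro i
    have h1 := (abs_le.1 (hin i)).1
    have h2 := htg i
    rw [hardThreshold, if_pos (by linarith)]
  have hhp : ∀ p, p ∉ Set.range q → hardThreshold t c p = 0 := by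
    intro p hp
    have h1 := (le_abs_self _).trans (hout p hp)
    rw [hardThreshold, if_neg (by linarith)]
  have hcpos : ∀ i, 0 < c (q i) := fun i => by
    have h1 := (abs_le.1 (hin i)).1
    have h2 := htg i
    linarith
  set S : ℝ := ∑ i, c (q i) with hS
  have hmemT : ∀ p ∈ (Finset.univ.image q)ᶜ, p ∉ Set.range q := fun p hp => by simpa using hp
  have hnorm : ∑ p, |hardThreshold t c p| = S := by
    rw [sum_eq_sum_add_sum_compl_image hq, Finset.sum_eq_zero (s := (Finset.univ.image q)ᶜ)
      fun p hp => by rw [hhp p (hmemT p hp), abs_zero], add_zero]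
    exact Finset.sum_congr rfl fun i _ => by rw [hhq, abs_of_pos (hcpos i)]
  have hS1 : |S - 1| ≤ k * η := by
    rw [hS, ← hg_sum, ← Finset.sum_sub_distrib]
    refine (Finset.abs_sum_le_sum_abs _ _).trans
      ((Finset.sum_le_sum fun i _ => hin i).trans_eq (by simp))
  have hS2 : 1 / 2 ≤ S := by
    have := (abs_le.1 hS1).1
    linarith
  have hSpos : 0 < S := by linarith
  have hrec : recoveredMeasure C t c =
      pointMeasure (fun i => c (q i) / S) (fun i => (q i : Sph n)) := by
    rw [recoveredMeasure, pointMeasure, pointMeasure, hnorm, sum_eq_sum_add_sum_compl_image hq,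
      Finset.sum_eq_zero (s := (Finset.univ.image q)ᶜ)
      fun p hp => by rw [hhp p (hmemT p hp), zero_div, ENNReal.ofReal_zero, zero_smul], add_zero]
    exact Finset.sum_congr rfl fun i _ => by rw [hhq]
  have hw : ∀ i, 0 ≤ c (q i) / S := fun i => (div_pos (hcpos i) hSpos).le
  have hw_sum : ∑ i, c (q i) / S = 1 := by rw [← Finset.sum_div, ← hS, div_self hSpos.ne']
  rw [hrec]
  refine ⟨isProbabilityMeasure_pointMeasure hw hw_sum _,
    wasserstein_pointMeasure_le hw (fun i => (hg i).le) hw_sum hg_sum hD ?_⟩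
  have hterm : ∀ i, |c (q i) / S - g i| ≤ 2 * (k + 1) * η := by
    intro i
    have hg1 : g i ≤ 1 := hg_sum ▸
      Finset.single_le_sum (f := g) (fun i _ => (hg i).le) (Finset.mem_univ i)
    have hnum : |(c (q i) - g i) - g i * (S - 1)| ≤ (k + 1) * η := by
      refine (abs_sub _ _).trans ?_
      rw [abs_mul, abs_of_pos (hg i)]
      have := mul_le_of_le_one_left (abs_nonneg (S - 1)) hg1
      linarith [hin i]
    -- Separates the coefficient error from the normalization error; dividing by `S ≥ 1 / 2` doubles
    -- both.
    have heq : c (q i) / S - g i = ((c (q i) - g i) - g i * (S - 1)) / S := by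
      field_simp
      ring
    rw [heq, abs_div, abs_of_pos hSpos, div_le_iff₀ hSpos]
    have : 0 ≤ (k + 1) * η := by positivity
    nlinarith
  refine (Finset.sum_le_sum fun i _ => hterm i).trans_eq ?_
  simp only [Finset.sum_const, Finset.card_univ, Fintype.card_fin, nsmul_eq_mul]
  ring

/-! ### Codes on the sphere -/

theorem continuous_sphInner {n : ℕ} : Continuous fun p : Sph n × Sph n => sphInner p.1 p.2 := by
  unfold sphInner
  fun_prop

theorem continuous_sphDist {n : ℕ} : Continuous fun p : Sph n × Sph n => sphDist p.1 p.2 :=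
  Real.continuous_arccos.comp continuous_sphInner

theorem sphDist_self {n : ℕ} (y : Sph n) : sphDist y y = 0 := by
  rw [sphDist, sphInner_self, Real.arccos_one]

theorem cos_sphDist {n : ℕ} (y z : Sph n) : Real.cos (sphDist y z) = sphInner y z :=
  Real.cos_arccos (abs_le.1 (abs_sphInner_le_one y z)).1 (abs_le.1 (abs_sphInner_le_one y z)).2

theorem tendsto_of_tendsto_sphDist {n : ℕ} {q : ℕ → Sph n} {y : Sph n}
    (h : Tendsto (fun j => sphDist (q j) y) atTop (𝓝 0)) : Tendsto q atTop (𝓝 y) := by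
  rw [tendsto_subtype_rng, tendsto_iff_norm_sub_tendsto_zero]
  have h1 : Tendsto (fun j => √(2 - 2 * Real.cos (sphDist (q j) y))) atTop (𝓝 0) := by
    have hc : Continuous fun t : ℝ => √(2 - 2 * Real.cos t) := by fun_prop
    have := (hc.tendsto 0).comp h
    simpa [Function.comp_def] using this
  refine h1.congr fun j => ?_
  rw [cos_sphDist, eq_comm, ← Real.sqrt_sq (norm_nonneg _), norm_sub_sq_real]
  congr 1
  have h2 : ∀ z : Sph n, ‖(z : EuclideanSpace ℝ (Fin n))‖ = 1 := fun z => by simp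
  rw [h2, h2, sphInner]
  ring

theorem bddAbove_codeInner {n : ℕ} (C : Finset (Sph n)) :
    BddAbove {s : ℝ | ∃ q ∈ C, ∃ q' ∈ C, q ≠ q' ∧ s = sphInner q q'} := by
  refine ⟨1, ?_⟩
  rintro s ⟨q, _, q', _, _, rfl⟩
  exact (abs_le.1 (abs_sphInner_le_one q q')).2

theorem sphInner_le_codeAlpha {n : ℕ} {C : Finset (Sph n)} {p q : Sph n} (hp : p ∈ C) (hq : q ∈ C)
    (h : p ≠ q) : sphInner p q ≤ codeAlpha C :=
  le_csSup (bddAbove_codeInner C) ⟨p, hp, q, hq, h, rfl⟩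

theorem codeAlpha_le_one {n : ℕ} (C : Finset (Sph n)) : codeAlpha C ≤ 1 := by
  refine Real.sSup_le ?_ zero_le_one
  rintro s ⟨q, _, q', _, _, rfl⟩
  exact (abs_le.1 (abs_sphInner_le_one q q')).2

theorem kssKernel_le_codeAlpha {n d : ℕ} {C : Finset (Sph n)} {p q : Sph n} (hp : p ∈ C)
    (hq : q ∈ C) (h : p ≠ q) : kssKernel d p q ≤ ((1 + codeAlpha C) / 2) ^ d :=
  pow_le_pow_left₀ (kssKernel_base_nonneg p q)
    (by linarith [sphInner_le_codeAlpha hp hq h]) d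

theorem exists_sphDist_le_codeTheta {n k : ℕ} {C : Finset (Sph n)} (hC : C.Nonempty)
    (x : Fin k → Sph n) (i : Fin k) : ∃ q : C, sphDist (q : Sph n) (x i) ≤ codeTheta C x := by
  have : Nonempty C := hC.to_subtype
  obtain ⟨q, hq⟩ := Finite.exists_min fun q : C => sphDist (q : Sph n) (x i)
  exact ⟨q, (le_ciInf hq).trans
    (le_ciSup (f := fun i => ⨅ q : C, sphDist (q : Sph n) (x i)) (Set.finite_range _).bddAbove i)⟩

theorem codeTheta_nonneg {n k : ℕ} (C : Finset (Sph n)) (x : Fin k → Sph n) :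
    0 ≤ codeTheta C x :=
  Real.iSup_nonneg fun _ => Real.iInf_nonneg fun _ => sphDist_nonneg _ _

theorem codeTheta_le {n k : ℕ} {C : Finset (Sph n)} {x : Fin k → Sph n} {ε : ℝ} (hε : 0 ≤ ε)
    (h : ∀ i, ∃ q ∈ C, sphDist q (x i) ≤ ε) : codeTheta C x ≤ ε := by
  refine Real.iSup_le (fun i => ?_) hε
  obtain ⟨q, hq, hqi⟩ := h i
  exact (ciInf_le (f := fun q : C => sphDist (q : Sph n) (x i)) (Set.finite_range _).bddBelow
    ⟨q, hq⟩).trans hqi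

theorem codeTheta_le_pi {n k : ℕ} {C : Finset (Sph n)} (hC : C.Nonempty) (x : Fin k → Sph n) :
    codeTheta C x ≤ Real.pi :=
  codeTheta_le Real.pi_pos.le fun _ => ⟨_, hC.choose_spec, sphDist_le_pi _ _⟩

theorem cos_codeTheta_pow_le_kssKernel {n k d : ℕ} {C : Finset (Sph n)} (hC : C.Nonempty)
    {x : Fin k → Sph n} {i : Fin k} {q : Sph n} (hq : sphDist q (x i) ≤ codeTheta C x) :
    ((1 + Real.cos (codeTheta C x)) / 2) ^ d ≤ kssKernel d q (x i) := by
  refine pow_le_pow_left₀ (by linarith [Real.neg_one_le_cos (codeTheta C x)]) ?_ d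
  have := Real.cos_le_cos_of_nonneg_of_le_pi (sphDist_nonneg _ _) (codeTheta_le_pi hC x) hq
  rw [cos_sphDist] at this
  linarith

theorem eventually_exists_mem_of_isOpen {X : Type*} [TopologicalSpace X] {C : ℕ → Finset X}
    (hC_mono : Monotone C) (hC_dense : Dense (⋃ j, (C j : Set X))) {U : Set X} (hU : IsOpen U)
    (hne : U.Nonempty) : ∀ᶠ j in atTop, ∃ q ∈ C j, q ∈ U := by
  obtain ⟨q, hqU, hq⟩ := hC_dense.inter_open_nonempty U hU hne
  obtain ⟨j₀, hj₀⟩ := Set.mem_iUnion.1 hq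
  filter_upwards [eventually_ge_atTop j₀] with j hj
  exact ⟨q, hC_mono hj hj₀, hqU⟩

theorem tendsto_codeTheta {n k : ℕ} {C : ℕ → Finset (Sph n)} (hC_mono : Monotone C)
    (hC_dense : Dense (⋃ j, (C j : Set (Sph n)))) (x : Fin k → Sph n) :
    Tendsto (fun j => codeTheta (C j) x) atTop (𝓝 0) := by
  refine Metric.tendsto_atTop'.2 fun ε hε => ?_
  have h : ∀ᶠ j in atTop, ∀ i, ∃ q ∈ C j, sphDist q (x i) < ε / 2 := by
    refine eventually_all.2 fun i => ?_
    have hc : Continuous fun q => sphDist q (x i) :=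
      continuous_sphDist.comp (f := fun q => (q, x i)) (by fun_prop)
    have hne : {q | sphDist q (x i) < ε / 2}.Nonempty :=
      ⟨x i, (sphDist_self (x i)).trans_lt (half_pos hε)⟩
    exact eventually_exists_mem_of_isOpen hC_mono hC_dense (isOpen_lt hc continuous_const) hne
  obtain ⟨N, hN⟩ := eventually_atTop.1 h
  refine ⟨N, fun j hj => ?_⟩
  rw [Real.dist_eq, sub_zero, abs_of_nonneg (codeTheta_nonneg _ _)]
  refine (codeTheta_le (half_pos hε).le fun i => ?_).trans_lt (half_lt_self hε)
  obtain ⟨q, hq, hqi⟩ := hN j hj.le i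
  exact ⟨q, hq, hqi.le⟩

theorem sphInner_eq_neg_one {n : ℕ} (hn : n ≤ 1) {y z : Sph n} (h : y ≠ z) :
    sphInner y z = -1 := by
  interval_cases n
  · exact absurd (Subtype.ext (Subsingleton.elim _ _)) h
  · have hy := sphInner_self y
    have hz := sphInner_self z
    rw [sphInner_eq_sum, Fin.sum_univ_one] at hy hz ⊢
    set a := (y : EuclideanSpace ℝ (Fin 1)) 0
    set b := (z : EuclideanSpace ℝ (Fin 1)) 0
    have hab : a - b ≠ 0 := by
      refine sub_ne_zero.2 fun hab => h (Subtype.ext ?_)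
      ext r
      rw [Fin.eq_zero r]
      exact hab
    have : (a - b) * (a + b) = 0 := by ring_nf; nlinarith
    have hab' : a + b = 0 := (mul_eq_zero.1 this).resolve_left hab
    have : b = -a := by linarith
    rw [this]
    linarith

/-- For fixed `N`, density provides two distinct code points so close that their degree-`N` kernel
exceeds `r`. Powers of a base in `[0, 1]` decrease in the exponent, so a degree below `N` would
violate the separation bound. -/
theorem tendsto_degree_atTop {n : ℕ} (hn : 1 < n) {C : ℕ → Finset (Sph n)}
    (hC_mono : Monotone C) (hC_dense : Dense (⋃ j, (C j : Set (Sph n)))) {d : ℕ → ℕ} {r : ℝ}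
    (hr : r < 1) (hsep : ∀ᶠ j in atTop, ((1 + codeAlpha (C j)) / 2) ^ d j < r) (y y' : Sph n)
    (hyy' : y ≠ y') : Tendsto d atTop atTop := by
  have hrank : 1 < Module.rank ℝ (EuclideanSpace ℝ (Fin n)) := by
    rw [← Module.finrank_eq_rank, finrank_euclideanSpace_fin]
    exact_mod_cast hn
  have hconn : ConnectedSpace (Sph n) :=
    Subtype.connectedSpace (isConnected_sphere hrank 0 zero_le_one)
  have hnontriv : Nontrivial (Sph n) := ⟨y, y', hyy'⟩
  refine tendsto_atTop.2 fun N => ?_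
  have hcont : Continuous fun p : Sph n × Sph n => kssKernel N p.1 p.2 := by
    unfold kssKernel
    exact ((continuous_const.add continuous_sphInner).div_const 2).pow N
  -- A connected space with two points has no isolated point, so the punctured neighbourhood filter
  -- at `y` is nontrivial.
  obtain ⟨z, hzr, hzy⟩ : ∃ z, r < kssKernel N y z ∧ z ≠ y := by
    have h1 : Tendsto (fun z => kssKernel N y z) (𝓝[≠] y) (𝓝 1) := by
      have hcy : Continuous fun z => kssKernel N y z :=
        hcont.comp (continuous_const.prodMk continuous_id)
      have := hcy.tendsto y
      rw [kssKernel_self] at this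
      exact this.mono_left nhdsWithin_le_nhds
    exact ((h1.eventually (lt_mem_nhds hr)).and self_mem_nhdsWithin).exists
  have hopen : IsOpen {p : Sph n × Sph n | r < kssKernel N p.1 p.2 ∧ p.1 ≠ p.2} :=
    (isOpen_lt continuous_const hcont).inter
      (isOpen_ne_fun continuous_fst continuous_snd)
  obtain ⟨⟨p, p'⟩, ⟨hpr, hpp'⟩, hp, hp'⟩ :=
    (hC_dense.prod hC_dense).inter_open_nonempty _ hopen ⟨(y, z), hzr, hzy.symm⟩
  obtain ⟨j₁, hj₁⟩ := Set.mem_iUnion.1 hp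
  obtain ⟨j₂, hj₂⟩ := Set.mem_iUnion.1 hp'
  filter_upwards [hsep, eventually_ge_atTop j₁, eventually_ge_atTop j₂] with j hj h1 h2
  by_contra hlt
  have hpC : p ∈ C j := hC_mono h1 hj₁
  have hpC' : p' ∈ C j := hC_mono h2 hj₂
  have h3 := kssKernel_le_codeAlpha (d := N) hpC hpC' hpp'
  have h4 : 0 ≤ (1 + codeAlpha (C j)) / 2 := (kssKernel_base_nonneg p p').trans
    (by linarith [sphInner_le_codeAlpha hpC hpC' hpp'])
  have h5 := pow_le_pow_of_le_one h4 (by linarith [codeAlpha_le_one (C j)]) (not_le.1 hlt).le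
  have h6 : r < kssKernel N p p' := hpr
  linarith

/-- Along codes that become dense, with degrees that separate the code points, the kernel decays
at any two distinct points of the sphere. -/
theorem tendsto_kssKernel_zero {n : ℕ} {C : ℕ → Finset (Sph n)}
    (hC_mono : Monotone C) (hC_dense : Dense (⋃ j, (C j : Set (Sph n)))) {d : ℕ → ℕ} {r : ℝ}
    (hr : r < 1) (hsep : ∀ᶠ j in atTop, ((1 + codeAlpha (C j)) / 2) ^ d j < r)
    {q q' : ℕ → Sph n} {y y' : Sph n} (hq : Tendsto q atTop (𝓝 y)) (hq' : Tendsto q' atTop (𝓝 y'))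
    (hyy' : y ≠ y') : Tendsto (fun j => kssKernel (d j) (q j) (q' j)) atTop (𝓝 0) := by
  rcases Nat.lt_or_ge 1 n with hn | hn
  · have hd := tendsto_degree_atTop hn hC_mono hC_dense hr hsep y y' hyy'
    obtain ⟨b, hb, hb1⟩ := exists_between (show (1 + sphInner y y') / 2 < 1 by
      linarith [sphInner_lt_one hyy'])
    have hb0 : 0 ≤ b := (kssKernel_base_nonneg y y').trans hb.le
    have hlim : Tendsto (fun j => (1 + sphInner (q j) (q' j)) / 2) atTop
        (𝓝 ((1 + sphInner y y') / 2)) :=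
      ((((continuous_sphInner.tendsto (y, y')).comp (hq.prodMk_nhds hq')).const_add 1).div_const 2)
    refine squeeze_zero' (Eventually.of_forall fun j => kssKernel_nonneg _ _) ?_
      ((tendsto_pow_atTop_nhds_zero_of_lt_one hb0 hb1).comp hd)
    filter_upwards [hlim.eventually (gt_mem_nhds hb)] with j hj
    exact pow_le_pow_left₀ (kssKernel_base_nonneg _ _) hj.le _
  -- On a sphere with at most two points the degrees need not grow. Distinct points are antipodal,
  -- so the kernel base is 0, and `d j ≠ 0` because `r < 1`.
  · refine tendsto_const_nhds.congr' ?_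
    have hne : ∀ᶠ j in atTop, q j ≠ q' j := by
      have := (hq.prodMk_nhds hq').eventually
        ((isOpen_ne_fun continuous_fst continuous_snd).mem_nhds hyy')
      exact this
    filter_upwards [hsep, hne] with j hj hjne
    have hd : d j ≠ 0 := fun h => by
      rw [h, pow_zero] at hj
      linarith
    rw [kssKernel, sphInner_eq_neg_one hn hjne]
    simp [hd]

/-! ### Recovery from a nearly exact empirical kernel -/

theorem toLp_residual {n k d m : ℕ} (a : Fin m → multiIndices n d → ℝ) (C : Finset (Sph n))
    {g : Fin k → ℝ} (hg : ∀ i, 0 ≤ g i) (x : Fin k → Sph n) (c : C → ℝ) :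
    WithLp.toLp 2 (measMatrix a C *ᵥ c - momentVec a (pointMeasure g x)) =
      ∑ p, c p • measVec a (p : Sph n) - ∑ i, g i • measVec a (x i) := by
  ext l
  simp [measMatrix, momentVec, integral_pointMeasure hg, measVec, Matrix.mulVec, dotProduct,
    mul_comm]

section Recovery

variable {n k d m : ℕ} {a : Fin m → multiIndices n d → ℝ} {C : Finset (Sph n)} {g : Fin k → ℝ}
  {x q : Fin k → Sph n} {δ κ : ℝ}

/-- Expand the square: the two squared norms are at most `1 + δ` and the inner product is at least
`κ - δ`. This is the source of `τ`. -/
theorem norm_measVec_sub_le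
    (hker : ∀ y z : Sph n, |inner ℝ (measVec a y) (measVec a z) - kssKernel d y z| ≤ δ)
    {y z : Sph n} (hκ : κ ≤ kssKernel d y z) :
    ‖measVec a y - measVec a z‖ ≤ √(2 - 2 * κ + 4 * δ) := by
  refine Real.le_sqrt_of_sq_le ?_
  rw [norm_sub_sq_real, ← real_inner_self_eq_norm_sq, ← real_inner_self_eq_norm_sq]
  have h1 := (abs_le.1 (hker y y)).2
  have h2 := (abs_le.1 (hker z z)).2
  have h3 := (abs_le.1 (hker y z)).1
  rw [kssKernel_self] at h1 h2
  linarith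

theorem norm_sum_measVec_sub_le
    (hker : ∀ y z : Sph n, |inner ℝ (measVec a y) (measVec a z) - kssKernel d y z| ≤ δ)
    (hg : ∀ i, 0 < g i) (hg_sum : ∑ i, g i = 1) (hκ : ∀ i, κ ≤ kssKernel d (q i) (x i)) :
    ‖∑ i, g i • measVec a (q i) - ∑ i, g i • measVec a (x i)‖ ≤ √(2 - 2 * κ + 4 * δ) := by
  rw [← Finset.sum_sub_distrib]
  refine (norm_sum_le _ _).trans ?_
  calc _ ≤ ∑ i, g i * √(2 - 2 * κ + 4 * δ) := by
        refine Finset.sum_le_sum fun i _ => ?_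
        rw [← smul_sub, norm_smul, Real.norm_of_nonneg (hg i).le]
        exact mul_le_mul_of_nonneg_left (norm_measVec_sub_le hker (hκ i)) (hg i).le
    _ = _ := by rw [← Finset.sum_mul, hg_sum, one_mul]

/-- The atoms of the measure, moved to the code, give a feasible vector of `ℓ¹` norm at most one. -/
theorem exists_isFeasible
    (hker : ∀ y z : Sph n, |inner ℝ (measVec a y) (measVec a z) - kssKernel d y z| ≤ δ)
    (hg : ∀ i, 0 < g i) (hg_sum : ∑ i, g i = 1) (hqC : ∀ i, q i ∈ C)
    (hκ : ∀ i, κ ≤ kssKernel d (q i) (x i)) :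
    ∃ c : C → ℝ, IsFeasible (measMatrix a C) (momentVec a (pointMeasure g x))
      √(2 - 2 * κ + 4 * δ) c ∧ ∑ p, |c p| ≤ 1 := by
  classical
  -- Summing over `i` allows several atoms to share a nearest code point.
  refine ⟨fun p => ∑ i, if (⟨q i, hqC i⟩ : C) = p then g i else 0, ?_, ?_⟩
  · rw [IsFeasible, toLp_residual a C (fun i => (hg i).le)]
    have : ∑ p : C, (∑ i, if (⟨q i, hqC i⟩ : C) = p then g i else 0) • measVec a (p : Sph n) =
        ∑ i, g i • measVec a (q i) := by
      simp only [Finset.sum_smul, ite_smul, zero_smul]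
      rw [Finset.sum_comm]
      simp only [Finset.sum_ite_eq, Finset.mem_univ, if_true]
    rw [this]
    exact norm_sum_measVec_sub_le hker hg hg_sum hκ
  · have hnn : ∀ p : C, 0 ≤ ∑ i, if (⟨q i, hqC i⟩ : C) = p then g i else 0 := fun p =>
      Finset.sum_nonneg fun i _ => by
        split_ifs
        exacts [(hg i).le, le_rfl]
    simp only [abs_of_nonneg (hnn _)]
    rw [Finset.sum_comm]
    simp only [Finset.sum_ite_eq, Finset.mem_univ, if_true, hg_sum, le_refl]

/-- Every optimum yields a probability measure close to the original one. -/
theorem recoveredMeasure_of_isL1Optimum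
    (hker : ∀ y z : Sph n, |inner ℝ (measVec a y) (measVec a z) - kssKernel d y z| ≤ δ)
    (hg : ∀ i, 0 < g i) (hg_sum : ∑ i, g i = 1) (hqC : ∀ i, q i ∈ C) (hq : Function.Injective q)
    (hκ : ∀ i, κ ≤ kssKernel d (q i) (x i)) (hδ1 : δ ≤ 1) (hδk : k * δ ≤ 7 / 100)
    (hβ : k * ((1 + codeAlpha C) / 2) ^ d ≤ 83 / 100) {t D η : ℝ} (htg : ∀ i, 2 * t ≤ g i)
    (hη : η = 11 * (k * (4 * √(2 - 2 * κ + 4 * δ) +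
      2 * (δ + ∑ i, ∑ i', if i' = i then 0 else kssKernel d (q i') (q i)))))
    (hηt : η < t) (hηk : k * η ≤ 1 / 2) (hD : ∀ i, sphDist (q i) (x i) ≤ D) {c : C → ℝ}
    (hc : IsL1Optimum (measMatrix a C) (momentVec a (pointMeasure g x))
      √(2 - 2 * κ + 4 * δ) c) :
    IsProbabilityMeasure (recoveredMeasure C t c) ∧
      wasserstein (recoveredMeasure C t c) (pointMeasure g x) ≤
        ENNReal.ofReal (D ^ 2 + Real.pi ^ 2 * (2 * k * (k + 1) * η)) ^ (1 / 2 : ℝ) := by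
  obtain ⟨c₀, hc₀, hc₀1⟩ := exists_isFeasible hker hg hg_sum hqC hκ
  set q' : Fin k → C := fun i => ⟨q i, hqC i⟩ with hq'
  have hq'inj : Function.Injective q' := fun i i' h => hq (congrArg Subtype.val h)
  have hfeas := hc.1
  rw [IsFeasible, toLp_residual a C (fun i => (hg i).le)] at hfeas
  have hs0 : ∀ i i', 0 ≤ if i' = i then 0 else kssKernel d (q i') (q i) := fun i i' => by
    split_ifs
    exacts [le_rfl, kssKernel_nonneg _ _]
  have hclose := abs_sub_le_of_nearly_orthonormal (fun p : C => measVec a (p : Sph n)) hq'inj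
    (σ := δ + ∑ i, ∑ i', if i' = i then 0 else kssKernel d (q i') (q i))
    hfeas (norm_sum_measVec_sub_le hker hg hg_sum hκ) ?_ (fun i => (hg i).le) hg_sum
    ((hc.2 c₀ hc₀).trans hc₀1) ?_ ?_
  · rw [← hη] at hclose
    exact recoveredMeasure_close hq'inj hg hg_sum htg hηt hηk hclose.1 hclose.2 hD
  · intro i
    have h1 := (abs_le.1 (hker (q i) (q i))).2
    rw [kssKernel_self, real_inner_self_eq_norm_sq] at h1
    exact le_of_sq_le_sq (by simp only [hq']; linarith) (by norm_num)
  · intro i i'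
    have h1 := hker (q i') (q i)
    have h2 : (if i' = i then 0 else kssKernel d (q i') (q i)) ≤
        ∑ i, ∑ i', if i' = i then 0 else kssKernel d (q i') (q i) :=
      (Finset.single_le_sum (f := fun i' => if i' = i then 0 else kssKernel d (q i') (q i))
        (fun i' _ => hs0 i i') (Finset.mem_univ i')).trans
      (Finset.single_le_sum (f := fun i => ∑ i', if i' = i then 0 else kssKernel d (q i') (q i))
        (fun i _ => Finset.sum_nonneg fun i' _ => hs0 i i') (Finset.mem_univ i))
    have h3 : |kssKernel d (q i') (q i) - (if i' = i then 1 else 0)| =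
        if i' = i then 0 else kssKernel d (q i') (q i) := by
      split_ifs with h
      · rw [h, kssKernel_self, sub_self, abs_zero]
      · rw [sub_zero, abs_of_nonneg (kssKernel_nonneg _ _)]
    exact (abs_sub_le _ (kssKernel d (q i') (q i)) _).trans (add_le_add h1 (h3.trans_le h2))
  · intro p hp
    have hterm : ∀ i, |inner ℝ (measVec a (p : Sph n)) (measVec a (q i))| ≤
        ((1 + codeAlpha C) / 2) ^ d + δ := by
      intro i
      have hne : (p : Sph n) ≠ q i := fun h => hp ⟨i, Subtype.ext h.symm⟩
      have h1 := abs_le.1 (hker p (q i))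
      have h2 := kssKernel_le_codeAlpha (d := d) p.2 (hqC i) hne
      have h3 := kssKernel_nonneg (d := d) (p : Sph n) (q i)
      exact abs_le.2 ⟨by linarith, by linarith⟩
    refine (Finset.sum_le_sum fun i _ => hterm i).trans ?_
    -- The budget 9/10 splits as 83/100 from the separation and 7/100 from the sampling error.
    rw [Finset.sum_const, Finset.card_univ, Fintype.card_fin, nsmul_eq_mul, mul_add]
    linarith

end Recovery

/-- Here `√2 - 1 < 83 / 200`, and `k ≤ 2 * (k - 1)` for `k ≥ 2` turns condition 1 into a bound with
factor `k`. For `k = 1` condition 1 says nothing, hence the extra assumption. -/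
theorem EasilyApproximableWith.eventually_code_bounds {n k : ℕ} (hk : k ≠ 0)
    {C : ℕ → Finset (Sph n)} {x : Fin k → Sph n} {d : ℕ → ℕ} (hd : EasilyApproximableWith C x d)
    (hd_one : k = 1 → ∀ᶠ j in atTop, ((1 + codeAlpha (C j)) / 2) ^ d j < √2 - 1) :
    ∀ᶠ j in atTop, ((1 + codeAlpha (C j)) / 2) ^ d j < 83 / 200 ∧
      k * ((1 + codeAlpha (C j)) / 2) ^ d j ≤ 83 / 100 := by
  have hsqrt : √2 < 283 / 200 := (Real.sqrt_lt' (by norm_num)).2 (by norm_num)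
  rcases Nat.lt_or_ge 1 k with h1 | h1
  · have hkR : (2 : ℝ) ≤ k := by exact_mod_cast h1
    filter_upwards [hd.separated] with j hj
    set β := ((1 + codeAlpha (C j)) / 2) ^ d j
    rcases le_or_gt 0 β with h | h
    · exact ⟨by nlinarith, by nlinarith⟩
    · exact ⟨by linarith, by nlinarith⟩
  · obtain rfl : k = 1 := by omega
    filter_upwards [hd_one rfl] with j hj
    exact ⟨by linarith, by push_cast; linarith⟩

end SphereMoments

/-! ### Choice of the parameters and passage to the limit -/

theorem mainTheorem4 {n k : ℕ} (g : Fin k → ℝ) (x : Fin k → SphereMoments.Sph n)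
    (hg_pos : ∀ i, 0 < g i) (hg_sum : ∑ i, g i = 1) (hx : Function.Injective x)
    (C : ℕ → Finset (SphereMoments.Sph n)) (hC_mono : Monotone C)
    (hC_dense : Dense (⋃ j, (C j : Set (SphereMoments.Sph n))))
    (d : ℕ → ℕ) (hd : SphereMoments.EasilyApproximableWith C x d)
    (hd_one : k = 1 →
      ∀ᶠ j in atTop, ((1 + SphereMoments.codeAlpha (C j)) / 2) ^ d j < √2 - 1) :
    ∃ (m : ℕ → ℕ) (τ : ℕ → ℝ), (∀ j, 0 < m j) ∧ (∀ j, 0 ≤ τ j) ∧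
      ∀ (Ω : Type*) [MeasurableSpace Ω] (P : Measure Ω) [IsProbabilityMeasure P]
        (A : ∀ j, Fin (m j) → SphereMoments.multiIndices n (d j) → Ω → ℝ),
        (∀ j, SphereMoments.IsKSSSample P (A j)) →
        ∀ᵐ ω ∂P,
          (∀ᶠ j in atTop, ∃ c : C j → ℝ,
            SphereMoments.IsL1Optimum
              (SphereMoments.measMatrix (fun i α => A j i α ω) (C j))
              (SphereMoments.momentVec (fun i α => A j i α ω) (SphereMoments.pointMeasure g x))
              (τ j) c) ∧
          ∀ c : ∀ j, C j → ℝ,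
            (∀ᶠ j in atTop,
              SphereMoments.IsL1Optimum
                (SphereMoments.measMatrix (fun i α => A j i α ω) (C j))
                (SphereMoments.momentVec (fun i α => A j i α ω) (SphereMoments.pointMeasure g x))
                (τ j) (c j)) →
            (∀ᶠ j in atTop, IsProbabilityMeasure
              (SphereMoments.recoveredMeasure (C j) ((1 / 2) * ⨅ i, g i) (c j))) ∧
            Tendsto (fun j => SphereMoments.wasserstein
              (SphereMoments.recoveredMeasure (C j) ((1 / 2) * ⨅ i, g i) (c j))
              (SphereMoments.pointMeasure g x)) atTop (𝓝 0) := by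
  have hk : k ≠ 0 := by
    rintro rfl
    simp at hg_sum
  have : NeZero k := ⟨hk⟩
  have hkerpos : ∀ j : ℕ, (0 : ℝ) < 1 / ((j : ℝ) + 1) := fun j => Nat.one_div_pos_of_nat
  choose m hm_pos hm using fun j => SphereMoments.exists_sampleSize n (d j) (hkerpos j)
    (show (0 : ℝ) < (1 / 2) ^ j by positivity)
  set θ : ℕ → ℝ := fun j => SphereMoments.codeTheta (C j) x with hθ
  set κ : ℕ → ℝ := fun j => ((1 + Real.cos (θ j)) / 2) ^ d j with hκ
  set τ : ℕ → ℝ := fun j => √(2 - 2 * κ j + 4 * (1 / ((j : ℝ) + 1))) with hτ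
  refine ⟨m, τ, hm_pos, fun j => Real.sqrt_nonneg _, ?_⟩
  intro Ω _ P _ A hA
  -- The convergent half of Borel-Cantelli: the failure probabilities are dominated by a geometric
  -- series.
  have hgood := ae_eventually_notMem (ne_top_of_le_ne_top
    (summable_geometric_two.tsum_ofReal_ne_top)
    (ENNReal.tsum_le_tsum fun j => hm j Ω P (A j) (hA j)))
  -- Nearest code points, and the convergence of the deterministic quantities.
  have hnonempty : ∀ᶠ j in atTop, (C j).Nonempty :=
    (SphereMoments.eventually_exists_mem_of_isOpen hC_mono hC_dense isOpen_univ
      ⟨x 0, Set.mem_univ _⟩).mono fun j ⟨q, hq, _⟩ => ⟨q, hq⟩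
  -- Early codes may be empty; the choice is then the irrelevant value `x i`.
  have hnear : ∀ j i, ∃ q, (C j).Nonempty → q ∈ C j ∧ SphereMoments.sphDist q (x i) ≤ θ j := by
    intro j i
    by_cases h : (C j).Nonempty
    · obtain ⟨q, hq⟩ := SphereMoments.exists_sphDist_le_codeTheta h x i
      exact ⟨q, fun _ => ⟨q.2, hq⟩⟩
    · exact ⟨x i, fun h' => absurd h' h⟩
  choose q hq using hnear
  have hθ0 : Tendsto θ atTop (𝓝 0) := SphereMoments.tendsto_codeTheta hC_mono hC_dense x
  have hq_lim : ∀ i, Tendsto (fun j => q j i) atTop (𝓝 (x i)) := fun i =>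
    SphereMoments.tendsto_of_tendsto_sphDist (squeeze_zero'
      (Eventually.of_forall fun j => SphereMoments.sphDist_nonneg _ _)
      (hnonempty.mono fun j hj => (hq j i hj).2) hθ0)
  have hq_inj : ∀ᶠ j in atTop, Function.Injective (q j) := by
    have h : ∀ i i', i ≠ i' → ∀ᶠ j in atTop, q j i ≠ q j i' := fun i i' hii' =>
      ((hq_lim i).prodMk_nhds (hq_lim i')).eventually
        ((isOpen_ne_fun continuous_fst continuous_snd).mem_nhds (hx.ne hii'))
    have h' : ∀ᶠ j in atTop, ∀ i i', i ≠ i' → q j i ≠ q j i' :=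
      eventually_all.2 fun i => eventually_all.2 fun i' => by
        by_cases hii' : i = i'
        · exact Eventually.of_forall fun j h => absurd hii' h
        · exact (h i i' hii').mono fun j hj _ => hj
    exact h'.mono fun j hj i i' heq => by_contra fun hne => hj i i' hne heq
  have hbounds := hd.eventually_code_bounds hk hd_one
  have hδ0 : Tendsto (fun j : ℕ => 1 / ((j : ℝ) + 1)) atTop (𝓝 0) :=
    tendsto_one_div_add_atTop_nhds_zero_nat
  have hτ0 : Tendsto τ atTop (𝓝 0) := by
    have h : Tendsto (fun j => 2 - 2 * κ j + 4 * (1 / ((j : ℝ) + 1))) atTop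
        (𝓝 (2 - 2 * 1 + 4 * 0)) :=
      (tendsto_const_nhds.sub (hd.close.const_mul 2)).add (hδ0.const_mul 4)
    have h' := (Real.continuous_sqrt.tendsto _).comp h
    norm_num at h'
    simpa [hτ, Function.comp_def] using h'
  have hσ0 : Tendsto (fun j => ∑ i, ∑ i', if i' = i then 0 else
      SphereMoments.kssKernel (d j) (q j i') (q j i)) atTop (𝓝 0) := by
    rw [show (0 : ℝ) = ∑ _i : Fin k, ∑ _i' : Fin k, 0 by simp]
    refine tendsto_finsetSum _ fun i _ => tendsto_finsetSum _ fun i' _ => ?_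
    by_cases h : i' = i
    · simp [h]
    · simp only [if_neg h]
      exact SphereMoments.tendsto_kssKernel_zero hC_mono hC_dense (by norm_num)
        (hbounds.mono fun j hj => hj.1) (hq_lim i') (hq_lim i) (hx.ne h)
  set η : ℕ → ℝ := fun j => 11 * (k * (4 * τ j + 2 * (1 / ((j : ℝ) + 1) +
    ∑ i, ∑ i', if i' = i then 0 else SphereMoments.kssKernel (d j) (q j i') (q j i)))) with hη
  have hη0 : Tendsto η atTop (𝓝 0) := by
    have h := (((hτ0.const_mul 4).add ((hδ0.add hσ0).const_mul 2)).const_mul (k : ℝ)).const_mul 11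
    simpa only [add_zero, mul_zero] using h
  have hkη : ∀ᶠ j in atTop, k * η j < 1 / 2 := by
    have h := hη0.const_mul (k : ℝ)
    rw [mul_zero] at h
    exact h.eventually (gt_mem_nhds (by norm_num))
  have hkδ : ∀ᶠ j : ℕ in atTop, k * (1 / ((j : ℝ) + 1)) < 7 / 100 := by
    have h := hδ0.const_mul (k : ℝ)
    rw [mul_zero] at h
    exact h.eventually (gt_mem_nhds (by norm_num))
  set t : ℝ := (1 / 2) * ⨅ i, g i with ht
  have ht_pos : 0 < t := by
    obtain ⟨i, hi⟩ := exists_eq_ciInf_of_finite (f := g)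
    rw [ht, ← hi]
    exact mul_pos (by norm_num) (hg_pos i)
  have htg : ∀ i, 2 * t ≤ g i := fun i => by
    have h := ciInf_le (Set.finite_range g).bddBelow i
    linarith
  have hbound0 : Tendsto (fun j => ENNReal.ofReal (θ j ^ 2 +
      Real.pi ^ 2 * (2 * k * (k + 1) * η j)) ^ (1 / 2 : ℝ)) atTop (𝓝 0) := by
    have h := (hθ0.pow 2).add ((hη0.const_mul (2 * k * (k + 1) : ℝ)).const_mul (Real.pi ^ 2))
    have h' := ((ENNReal.continuous_rpow_const (y := (1 / 2 : ℝ))).tendsto _).comp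
      (ENNReal.tendsto_ofReal h)
    simpa [Function.comp_def] using h'
  filter_upwards [hgood] with ω hω
  have hker : ∀ᶠ j in atTop, ∀ y z : SphereMoments.Sph n,
      |inner ℝ (SphereMoments.measVec (fun i γ => A j i γ ω) y)
        (SphereMoments.measVec (fun i γ => A j i γ ω) z) - SphereMoments.kssKernel (d j) y z| ≤
        1 / ((j : ℝ) + 1) :=
    hω.mono fun j hj => not_not.1 hj
  have hκq : ∀ j, (C j).Nonempty → ∀ i, κ j ≤ SphereMoments.kssKernel (d j) (q j i) (x i) :=
    fun j hj i => SphereMoments.cos_codeTheta_pow_le_kssKernel hj (hq j i hj).2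
  refine ⟨?_, fun c hc => ?_⟩
  · filter_upwards [hker, hnonempty] with j hj hne
    obtain ⟨c, hc, _⟩ := SphereMoments.exists_isFeasible hj hg_pos hg_sum
      (fun i => (hq j i hne).1) (hκq j hne)
    exact SphereMoments.exists_isL1Optimum ⟨c, hc⟩
  · have hall : ∀ᶠ j in atTop,
        IsProbabilityMeasure (SphereMoments.recoveredMeasure (C j) t (c j)) ∧
        SphereMoments.wasserstein (SphereMoments.recoveredMeasure (C j) t (c j))
          (SphereMoments.pointMeasure g x) ≤ ENNReal.ofReal (θ j ^ 2 +
            Real.pi ^ 2 * (2 * k * (k + 1) * η j)) ^ (1 / 2 : ℝ) := by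
      filter_upwards [hker, hnonempty, hq_inj, hbounds, hkη, hkδ,
        hη0.eventually (gt_mem_nhds ht_pos), hδ0.eventually (gt_mem_nhds one_pos), hc]
        with j hj hne hinj hbd hkη hkδ hηt hδ1 hc
      exact SphereMoments.recoveredMeasure_of_isL1Optimum hj hg_pos hg_sum
        (fun i => (hq j i hne).1) hinj (hκq j hne) hδ1.le hkδ.le hbd.2 htg rfl hηt hkη.le
        (fun i => (hq j i hne).2) hc
    exact ⟨hall.mono fun j hj => hj.1, tendsto_of_tendsto_of_tendsto_of_le_of_le'
      tendsto_const_nhds hbound0 (Eventually.of_forall fun j => zero_le) (hall.mono fun j hj => hj.2)⟩
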